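/- Let $k\in[0,1]$ and $p\in(0,2]$. Let $\mathcal{H}_k$ be the class of harmonic mappings $f=h+\overline{g}$ of the unit disk $\mathbb{D}=\{z\in\mathbb{C}:|z|<1\}$, where $h(z)=\sum_{n=0}^\infty a_nz^n$ and $g(z)=\sum_{n=1}^\infty b_nz^n$ are analytic in $\mathbb{D}$ (so $g(0)=0$), with $|h(z)|\le 1$ and $|g'(z)|\le k|h'(z)|$ for all $z\in\mathbb{D}$. For $F(z)=\sum_{n\ge1}c_nz^n$ analytic in $\mathbb{D}$ and $r\in[0,1)$ put $\|F\|_r^2=\sum_{n=1}^\infty|c_n|^2r^{2n}$; put $h_0(z)=h(z)-h(0)$, $c(0)=0$, $c(k)=1/k$ for $k\in(0,1]$, and $$E_f(k,r)=\sum_{n=1}^\infty|a_n|r^n+\sum_{n=1}^\infty|b_n|r^n+\frac{1}{1+|a_0|}\left(\frac{1+|a_0|r}{1-r}\right)\left(\|h_0\|_r^2+c(k)\|g\|_r^2\right).$$ (1) Let $f=h+\overline g\in\mathcal{H}_k$ with $h$ not constant, and let $q$ be the order of the zero of $h_0$ at $0$. If $|b_q|\le\frac{1}{2k|a_q|}$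 (no condition when $k=0$), then $$|h(0)|^p+E_f(k,r)\le1\quad\text{for all } 0\le r\le\frac{p}{2(1+k)+p}.\qquad(*)$$ (2) Suppose that $k=0$, or $k=1$, or $p\in(0,1]$, or that $k\in(0,1)$, $p\in(1,2)$ and $k\ge p-1$. Then $(*)$ holds for every $f\in\mathcal{H}_k$, without any condition on $b_q$, and it is sharp: the constant $\frac{p}{2(1+k)+p}$ cannot be improved, that is, for every $r$ with $\frac{p}{2(1+k)+p}<r<1$ there is an $f=h+\overline g\in\mathcal{H}_k$ with $|h(0)|^p+E_f(k,r)>1$. -/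

import Mathlib

open scoped Nat ComplexConjugate

noncomputable section

/-- A harmonic mapping `f = h + conj g` of the unit disk, given by its (unique) canonical
decomposition: `h` and `g` are analytic in the open unit disk and `g 0 = 0`. Values outside the
disk play no role. -/
structure HarmonicMapping where
  h : ℂ → ℂ
  g : ℂ → ℂ
  analytic_h : AnalyticOnNhd ℂ h (Metric.ball 0 1)
  analytic_g : AnalyticOnNhd ℂ g (Metric.ball 0 1)
  g_zero : g 0 = 0

/-- The underlying function `z ↦ h z + conj (g z)`. -/
instance : CoeFun HarmonicMapping (fun _ => ℂ → ℂ) where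
  coe f := fun z => f.h z + conj (f.g z)

/-- The class `𝓗_k`: harmonic mappings `f = h + conj g` with `|h| ≤ 1` and `|g'| ≤ k |h'|`
in the unit disk. -/
def harmonicClass (k : ℝ) : Set HarmonicMapping :=
  {f | (∀ z ∈ Metric.ball (0 : ℂ) 1, ‖f.h z‖ ≤ 1) ∧
    ∀ z ∈ Metric.ball (0 : ℂ) 1, ‖deriv f.g z‖ ≤ k * ‖deriv f.h z‖}

/-- The `n`-th Taylor coefficient of `F` at `0`. -/
def taylorCoeff (F : ℂ → ℂ) (n : ℕ) : ℂ := iteratedDeriv n F 0 / (n ! : ℂ)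

/-- `∑_{n ≥ 1} |c_n| r ^ n`, where `c_n` are the Taylor coefficients of `F` at `0`. -/
def majorantSum (F : ℂ → ℂ) (r : ℝ) : ℝ :=
  ∑' n : ℕ, ‖taylorCoeff F (n + 1)‖ * r ^ (n + 1)

/-- `‖F‖_r ^ 2 = ∑_{n ≥ 1} |c_n| ^ 2 r ^ (2 n)`, where `c_n` are the Taylor coefficients of `F`
at `0` (used for `F 0 = 0`). -/
def radialNormSq (F : ℂ → ℂ) (r : ℝ) : ℝ :=
  ∑' n : ℕ, ‖taylorCoeff F (n + 1)‖ ^ 2 * r ^ (2 * (n + 1))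

/-- The constant `c(k)`: `0` for `k = 0` and `1 / k` otherwise. -/
def cConst (k : ℝ) : ℝ := if k = 0 then 0 else 1 / k

namespace HarmonicMapping

/-- The Taylor coefficients `a_n` of the analytic part `h`. -/
def a (f : HarmonicMapping) (n : ℕ) : ℂ := taylorCoeff f.h n

/-- The Taylor coefficients `b_n` of the co-analytic part `g`. -/
def b (f : HarmonicMapping) (n : ℕ) : ℂ := taylorCoeff f.g n

/-- `h₀(z) = h(z) - h(0)`. -/
def h₀ (f : HarmonicMapping) : ℂ → ℂ := fun z => f.h z - f.h 0

/-- The quantity `E_f(k, r)`. -/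
def E (f : HarmonicMapping) (k r : ℝ) : ℝ :=
  majorantSum f.h r + majorantSum f.g r +
    1 / (1 + ‖f.a 0‖) * ((1 + ‖f.a 0‖ * r) / (1 - r)) *
      (radialNormSq f.h₀ r + cConst k * radialNormSq f.g r)

end HarmonicMapping

/-- The series in `majorantSum` converges for functions analytic in the unit disk. -/
theorem summable_majorantSum {F : ℂ → ℂ} (hF : AnalyticOnNhd ℂ F (Metric.ball 0 1)) {r : ℝ}
    (hr0 : 0 ≤ r) (hr1 : r < 1) :
    Summable fun n : ℕ => ‖taylorCoeff F (n + 1)‖ * r ^ (n + 1) := by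
  have hz : (r : ℂ) ∈ Metric.ball (0 : ℂ) 1 := by
    simpa [abs_of_nonneg hr0] using hr1
  have h := (Complex.hasSum_taylorSeries_on_ball hF.differentiableOn hz).summable.norm
  refine ((summable_nat_add_iff 1).2 h).congr fun n => ?_
  simp only [taylorCoeff, smul_eq_mul, sub_zero, norm_mul, norm_div, norm_inv, norm_pow,
    Complex.norm_real, Real.norm_of_nonneg hr0]
  ring

/-- The series in `radialNormSq` converges for functions analytic in the unit disk. -/
theorem summable_radialNormSq {F : ℂ → ℂ} (hF : AnalyticOnNhd ℂ F (Metric.ball 0 1)) {r : ℝ}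
    (hr0 : 0 ≤ r) (hr1 : r < 1) :
    Summable fun n : ℕ => ‖taylorCoeff F (n + 1)‖ ^ 2 * r ^ (2 * (n + 1)) := by
  have h := summable_majorantSum hF hr0 hr1
  have h0 : ∀ n : ℕ, 0 ≤ ‖taylorCoeff F (n + 1)‖ * r ^ (n + 1) := fun n => by positivity
  have h2 := h.mul_of_nonneg h h0 h0
  have h3 := h2.comp_injective (i := fun n : ℕ => (n, n)) (fun m n hmn => (Prod.mk.inj hmn).1)
  refine h3.congr fun n => ?_
  simp only [Function.comp]
  ring

end

/-! Both halves rest on one estimate, `harmonicClass_E_le`: for every f in the class and r ≤ 1/2,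
E_f(k,r) ≤ (1+k)(1-|a₀|²) r/(1-r). The stated radius is at most 1/2 because p ≤ 2, and it is exactly
the condition (1+k) r/(1-r) ≤ p/2. Bernoulli's inequality x^p ≤ 1 - (p/2)(1-x²) with x = |h(0)| then
gives (*).

The h-part of the estimate is the refined Bohr inequality `IsSchur.refined_bohr`, which sums
Carlson's inequalities |a_N| + Σ_{j<N/2} |a_j|² + … ≤ 1. These follow by duality from the fact that
multiplication by a bounded analytic function contracts the ℓ² norm of the first N coefficients
(`IsSchur.truncNormSq_mul_le`, by the Schur algorithm).

For the g-part, g' = kωh' with |ω| ≤ 1, and c(k)k² = k lets one factor k out. What remains is that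
the coefficients d of an antiderivative of ωh' satisfy the same bound as those of h when r ≤ 1/2
(`majorant_le`). If r < |a₀|, a weighted AM-GM adapted to the Möbius coefficients suffices, with ℓ²
information only. If r ≥ |a₀|, either a Bohr-type convolution bound with |ω_j| ≤ 1-|ω₀|² applies (r
≤ 1/3, or a large first coefficient), or the first coefficient is small and crude ℓ² bounds are
enough.

For sharpness, h(z) = (a-z)/(1-az) and g = k(h-h(0)) give equality in the estimate, and a tends to 1
from below. -/

open Metric Set Filter Topology
open PowerSeries (coeff)

/-! ### Taylor coefficients as formal power series -/

/-- The Taylor series of `F` at `0`, as a formal power series. -/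
noncomputable def taylorPS (F : ℂ → ℂ) : PowerSeries ℂ := PowerSeries.mk (taylorCoeff F)

@[simp] theorem coeff_taylorPS (F : ℂ → ℂ) (n : ℕ) :
    PowerSeries.coeff n (taylorPS F) = taylorCoeff F n := by
  simp [taylorPS]

theorem taylorCoeff_zero (F : ℂ → ℂ) : taylorCoeff F 0 = F 0 := by
  simp [taylorCoeff]

theorem taylorPS_congr {F G : ℂ → ℂ} (h : F =ᶠ[𝓝 0] G) : taylorPS F = taylorPS G := by
  ext n
  simp [taylorCoeff, h.iteratedDeriv_eq n]

theorem taylorPS_mul {F G : ℂ → ℂ} (hF : AnalyticAt ℂ F 0) (hG : AnalyticAt ℂ G 0) :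
    taylorPS (F * G) = taylorPS F * taylorPS G := by
  ext m
  simp only [coeff_taylorPS, taylorCoeff, PowerSeries.coeff_mul,
    iteratedDeriv_mul hF.contDiffAt hG.contDiffAt, Finset.sum_div,
    Finset.Nat.sum_antidiagonal_eq_sum_range_succ_mk, Nat.succ_eq_add_one]
  refine Finset.sum_congr rfl fun i hi ↦ ?_
  rw [Nat.cast_choose _ (by grind)]
  field_simp [Nat.factorial_ne_zero]

theorem taylorPS_sub {F G : ℂ → ℂ} (hF : AnalyticAt ℂ F 0) (hG : AnalyticAt ℂ G 0) :
    taylorPS (F - G) = taylorPS F - taylorPS G := by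
  ext m
  simp [taylorCoeff, iteratedDeriv_sub hF.contDiffAt hG.contDiffAt, sub_div]

theorem taylorPS_const (c : ℂ) : taylorPS (fun _ => c) = PowerSeries.C c := by
  ext m
  rcases Nat.eq_zero_or_pos m with rfl | hm
  · simp [taylorCoeff]
  · simp [taylorCoeff, iteratedDeriv_const, PowerSeries.coeff_C, hm.ne']

theorem taylorPS_id : taylorPS (fun z => z) = PowerSeries.X := by
  ext m
  simp only [coeff_taylorPS, taylorCoeff, PowerSeries.coeff_X]
  match m with
  | 0 => simp
  | 1 => simp [iteratedDeriv_one]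
  | m + 2 =>
    rw [iteratedDeriv_succ', iteratedDeriv_succ']
    simp

theorem taylorCoeff_deriv (F : ℂ → ℂ) (n : ℕ) :
    taylorCoeff (deriv F) n = (n + 1) * taylorCoeff F (n + 1) := by
  simp only [taylorCoeff, iteratedDeriv_succ', Nat.factorial_succ]
  have := Nat.factorial_ne_zero n
  have h2 : (n : ℂ) + 1 ≠ 0 := by exact_mod_cast Nat.succ_ne_zero n
  push_cast
  field_simp

/-! ### Schur functions: the Schur algorithm and division -/

/-- A Schur function: analytic in the unit disk and bounded by `1` there. -/
def IsSchur (F : ℂ → ℂ) : Prop :=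
  AnalyticOnNhd ℂ F (ball 0 1) ∧ ∀ z ∈ ball (0 : ℂ) 1, ‖F z‖ ≤ 1

theorem zero_mem_unitBall : (0 : ℂ) ∈ ball (0 : ℂ) 1 := by simp

theorem IsSchur.analyticAt_zero {F : ℂ → ℂ} (hF : IsSchur F) : AnalyticAt ℂ F 0 :=
  hF.1 0 zero_mem_unitBall

theorem IsSchur.norm_zero_le {F : ℂ → ℂ} (hF : IsSchur F) : ‖F 0‖ ≤ 1 :=
  hF.2 0 zero_mem_unitBall

/-- Maximum principle; this is the case in which the Schur algorithm stops. -/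
theorem IsSchur.taylorPS_eq_const {F : ℂ → ℂ} (hF : IsSchur F) (h1 : ‖F 0‖ = 1) :
    taylorPS F = PowerSeries.C (F 0) := by
  have h := Complex.eqOn_of_isPreconnected_of_isMaxOn_norm
    (convex_ball (0 : ℂ) 1).isPreconnected isOpen_ball hF.1.differentiableOn zero_mem_unitBall
    (fun z hz => by simpa [h1] using hF.2 z hz)
  rw [← taylorPS_const]
  exact taylorPS_congr (h.eventuallyEq_of_mem (ball_mem_nhds 0 one_pos))

theorem normSq_one_sub_conj_mul_sub (c w : ℂ) :
    ‖1 - conj c * w‖ ^ 2 - ‖c - w‖ ^ 2 = (1 - ‖c‖ ^ 2) * (1 - ‖w‖ ^ 2) := by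
  simp only [← Complex.normSq_eq_norm_sq, Complex.normSq_apply, Complex.sub_re, Complex.sub_im,
    Complex.mul_re, Complex.mul_im, Complex.conj_re, Complex.conj_im, Complex.one_re,
    Complex.one_im]
  ring

/-- One step of the Schur algorithm. -/
theorem IsSchur.exists_schur_step {F : ℂ → ℂ} (hF : IsSchur F) (h1 : ‖F 0‖ < 1) :
    ∃ ψ, IsSchur ψ ∧ PowerSeries.C (F 0) - taylorPS F =
      PowerSeries.X * taylorPS ψ * (1 - PowerSeries.C (conj (F 0)) * taylorPS F) := by
  have hne : ∀ z ∈ ball (0 : ℂ) 1, 1 - conj (F 0) * F z ≠ 0 := by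
    intro z hz h0
    have h2 : ‖conj (F 0) * F z‖ = 1 := by rw [← sub_eq_zero.1 h0]; simp
    rw [norm_mul, RCLike.norm_conj] at h2
    have := hF.2 z hz
    nlinarith [norm_nonneg (F 0), norm_nonneg (F z)]
  set G : ℂ → ℂ := fun z => (F 0 - F z) / (1 - conj (F 0) * F z) with hG
  have hGan : AnalyticOnNhd ℂ G (ball 0 1) := fun z hz =>
    (analyticAt_const.sub (hF.1 z hz)).div
      (analyticAt_const.sub (analyticAt_const.mul (hF.1 z hz))) (hne z hz)
  have hG0 : G 0 = 0 := by simp [hG]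
  have hmaps : MapsTo G (ball 0 1) (closedBall (G 0) 1) := by
    intro z hz
    rw [hG0, mem_closedBall_zero_iff, hG, norm_div]
    refine div_le_one_of_le₀ ?_ (norm_nonneg _)
    refine le_of_sq_le_sq ?_ (norm_nonneg _)
    have := normSq_one_sub_conj_mul_sub (F 0) (F z)
    have h3 := hF.2 z hz
    have h4 : 0 ≤ (1 - ‖F 0‖ ^ 2) * (1 - ‖F z‖ ^ 2) := by
      apply mul_nonneg <;> nlinarith [norm_nonneg (F 0), norm_nonneg (F z)]
    linarith
  have hψan : AnalyticOnNhd ℂ (dslope G 0) (ball 0 1) :=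
    ((Complex.differentiableOn_dslope (ball_mem_nhds 0 one_pos)).2
      hGan.differentiableOn).analyticOnNhd isOpen_ball
  refine ⟨dslope G 0, ⟨hψan, fun z hz => ?_⟩, ?_⟩
  · simpa using Complex.norm_dslope_le_div_of_mapsTo_ball hGan.differentiableOn hmaps hz
  · have hψ0 := hψan 0 zero_mem_unitBall
    have hF0 := hF.analyticAt_zero
    have hid : AnalyticAt ℂ (fun z : ℂ => z) 0 := analyticAt_id
    have e1 : (fun _ => F 0) - F =ᶠ[𝓝 0]
        ((fun z => z) * dslope G 0) * ((fun _ => 1) - (fun _ => conj (F 0)) * F) := by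
      filter_upwards [ball_mem_nhds (0 : ℂ) one_pos] with z hz
      have h5 : z * dslope G 0 z = G z := by
        have := sub_smul_dslope G 0 z
        simpa [hG0] using this
      simp only [Pi.sub_apply, Pi.mul_apply, h5]
      rw [hG, div_mul_cancel₀ _ (hne z hz)]
    have e2 := taylorPS_congr e1
    rw [taylorPS_sub analyticAt_const hF0, taylorPS_mul (hid.mul hψ0)
      (analyticAt_const.sub (analyticAt_const.mul hF0)), taylorPS_mul hid hψ0,
      taylorPS_sub analyticAt_const (analyticAt_const.mul hF0),
      taylorPS_mul analyticAt_const hF0, taylorPS_const, taylorPS_const, taylorPS_const,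
      taylorPS_id, map_one] at e2
    exact e2

/-- Division of analytic functions in the unit disk: `‖v‖ ≤ ‖u‖` implies `v = ω u` with a Schur
function `ω`. -/
theorem exists_schur_mul_eq {u v : ℂ → ℂ} (hu : AnalyticOnNhd ℂ u (ball 0 1))
    (hv : AnalyticOnNhd ℂ v (ball 0 1)) (huv : ∀ z ∈ ball (0 : ℂ) 1, ‖v z‖ ≤ ‖u z‖) :
    ∃ ω, IsSchur ω ∧ taylorPS v = taylorPS ω * taylorPS u := by
  by_cases hz : ∀ᶠ z in 𝓝 (0 : ℂ), u z = 0
  · refine ⟨fun _ => 0, ⟨fun _ _ => analyticAt_const, by simp⟩, ?_⟩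
    rw [taylorPS_const, map_zero, zero_mul, ← map_zero (PowerSeries.C (R := ℂ)), ← taylorPS_const]
    apply taylorPS_congr
    filter_upwards [hz, ball_mem_nhds (0 : ℂ) one_pos] with z h1 h2
    simpa [h1] using huv z h2
  have hne : ∀ x ∈ ball (0 : ℂ) 1, ∀ᶠ z in 𝓝[≠] x, u z ≠ 0 := by
    intro x hx
    refine (hu x hx).eventually_eq_zero_or_eventually_ne_zero.resolve_left fun h => hz ?_
    have := hu.eqOn_zero_of_preconnected_of_eventuallyEq_zero
      (convex_ball (0 : ℂ) 1).isPreconnected hx h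
    exact this.eventuallyEq_of_mem (ball_mem_nhds 0 one_pos)
  have hm : MeromorphicOn (v / u) (ball 0 1) := fun x hx =>
    (hv x hx).meromorphicAt.div (hu x hx).meromorphicAt
  set ω := toMeromorphicNFOn (v / u) (ball 0 1) with hω
  have hev : ∀ x ∈ ball (0 : ℂ) 1, ∀ᶠ z in 𝓝[≠] x, ω z * u z = v z ∧ ‖ω z‖ ≤ 1 := by
    intro x hx
    filter_upwards [hne x hx, hm.toMeromorphicNFOn_eq_self_on_nhdsNE hx,
      nhdsWithin_le_nhds (isOpen_ball.mem_nhds hx)] with z h1 h2 h3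
    rw [hω, h2]
    refine ⟨div_mul_cancel₀ _ h1, ?_⟩
    rw [Pi.div_apply, norm_div]
    exact div_le_one_of_le₀ (huv z h3) (norm_nonneg _)
  have han : AnalyticOnNhd ℂ ω (ball 0 1) := by
    intro x hx
    have hnf : MeromorphicNFAt ω x := meromorphicNFOn_toMeromorphicNFOn (v / u) (ball 0 1) hx
    refine (hnf.meromorphicOrderAt_nonneg_iff_analyticAt).1 (not_lt.1 fun hlt => ?_)
    -- At a pole `ω` would be unbounded, contradicting `‖ω‖ ≤ 1` on a punctured neighbourhood.
    have ht := tendsto_cobounded_of_meromorphicOrderAt_neg hlt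
    have h1 : ∀ᶠ z in 𝓝[≠] x, 1 < ‖ω z‖ :=
      (tendsto_norm_cobounded_atTop.comp ht).eventually_gt_atTop 1
    obtain ⟨z, h2, h3⟩ := (h1.and (hev x hx)).exists
    exact absurd h3.2 (not_le.2 h2)
  have hcont : ∀ x ∈ ball (0 : ℂ) 1, ω x * u x = v x ∧ ‖ω x‖ ≤ 1 := by
    intro x hx
    have c1 : Tendsto ω (𝓝[≠] x) (𝓝 (ω x)) := (han x hx).continuousAt.tendsto.mono_left
      nhdsWithin_le_nhds
    have c2 : Tendsto u (𝓝[≠] x) (𝓝 (u x)) := (hu x hx).continuousAt.tendsto.mono_left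
      nhdsWithin_le_nhds
    have c3 : Tendsto v (𝓝[≠] x) (𝓝 (v x)) := (hv x hx).continuousAt.tendsto.mono_left
      nhdsWithin_le_nhds
    refine ⟨tendsto_nhds_unique (c1.mul c2) (c3.congr' ?_), le_of_tendsto c1.norm ?_⟩
    · filter_upwards [hev x hx] with z h using h.1.symm
    · filter_upwards [hev x hx] with z h using h.2
  refine ⟨ω, ⟨han, fun z hz => (hcont z hz).2⟩, ?_⟩
  rw [← taylorPS_mul (han 0 zero_mem_unitBall) (hu 0 zero_mem_unitBall)]
  apply taylorPS_congr
  filter_upwards [ball_mem_nhds (0 : ℂ) one_pos] with z h using (hcont z h).1.symm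

/-! ### Contraction of truncated ℓ² norms -/

/-- The squared `ℓ²` norm of the first `N` coefficients. -/
noncomputable def truncNormSq (N : ℕ) (f : PowerSeries ℂ) : ℝ :=
  ∑ n ∈ Finset.range N, ‖coeff n f‖ ^ 2

theorem truncNormSq_mono (f : PowerSeries ℂ) {M N : ℕ} (h : M ≤ N) :
    truncNormSq M f ≤ truncNormSq N f :=
  Finset.sum_le_sum_of_subset_of_nonneg (Finset.range_mono h) fun _ _ _ => by positivity

theorem truncNormSq_X_mul (N : ℕ) (f : PowerSeries ℂ) :
    truncNormSq (N + 1) (PowerSeries.X * f) = truncNormSq N f := by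
  simp [truncNormSq, Finset.sum_range_succ', PowerSeries.coeff_succ_X_mul]

/-- The Möbius identity |1 - c̄w|² - |c - w|² = (1-|c|²)(1-|w|²), homogenised and summed over
coefficients. -/
theorem truncNormSq_sub_conj (N : ℕ) (c : ℂ) (f g : PowerSeries ℂ) :
    truncNormSq N (f - PowerSeries.C (conj c) * g) - truncNormSq N (PowerSeries.C c * f - g) =
      (1 - ‖c‖ ^ 2) * (truncNormSq N f - truncNormSq N g) := by
  simp only [truncNormSq, ← Finset.sum_sub_distrib, Finset.mul_sum]
  refine Finset.sum_congr rfl fun n _ => ?_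
  simp only [map_sub, PowerSeries.coeff_C_mul, ← Complex.normSq_eq_norm_sq, Complex.normSq_apply,
    Complex.sub_re, Complex.sub_im, Complex.mul_re, Complex.mul_im, Complex.conj_re,
    Complex.conj_im]
  ring

/-- Multiplication by a Schur function contracts the truncated `ℓ²` norms. -/
theorem IsSchur.truncNormSq_mul_le {F : ℂ → ℂ} (hF : IsSchur F) (N : ℕ) (f : PowerSeries ℂ) :
    truncNormSq N (taylorPS F * f) ≤ truncNormSq N f := by
  induction N generalizing F f with
  | zero => simp [truncNormSq]
  | succ N ih =>
    rcases hF.norm_zero_le.lt_or_eq with h1 | h1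
    · obtain ⟨ψ, hψ, e⟩ := hF.exists_schur_step h1
      -- The Schur step turns F(0)f - Ff into zψx. The factor z uses up one coefficient, so the
      -- induction hypothesis at N applies to ψ.
      set x := f - PowerSeries.C (conj (F 0)) * (taylorPS F * f) with hx
      have hy : PowerSeries.C (F 0) * f - taylorPS F * f = PowerSeries.X * (taylorPS ψ * x) := by
        rw [← sub_mul, e, hx]; ring
      have h2 := truncNormSq_sub_conj (N + 1) (F 0) f (taylorPS F * f)
      rw [← hx, hy, truncNormSq_X_mul] at h2
      have h3 := (ih hψ x).trans (truncNormSq_mono x N.le_succ)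
      have h4 : 0 < 1 - ‖F 0‖ ^ 2 := by nlinarith [norm_nonneg (F 0)]
      have h5 : 0 ≤ (1 - ‖F 0‖ ^ 2) * (truncNormSq (N + 1) f - truncNormSq (N + 1) (taylorPS F * f)) := by
        linarith
      linarith [nonneg_of_mul_nonneg_right h5 h4]
    · rw [hF.taylorPS_eq_const h1]
      simp [truncNormSq, PowerSeries.coeff_C_mul, h1]

theorem IsSchur.sum_sq_le_one {F : ℂ → ℂ} (hF : IsSchur F) (N : ℕ) :
    ∑ n ∈ Finset.range N, ‖taylorCoeff F n‖ ^ 2 ≤ 1 := by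
  have h := hF.truncNormSq_mul_le N 1
  simp only [truncNormSq, mul_one, coeff_taylorPS, PowerSeries.coeff_one] at h
  refine h.trans ?_
  have : ∀ n : ℕ, ‖(if n = 0 then (1 : ℂ) else 0)‖ ^ 2 = if n = 0 then (1 : ℝ) else 0 := by
    intro n; split_ifs <;> simp
  simp only [this, Finset.sum_ite_eq']
  split_ifs <;> norm_num

theorem re_conj_mul_le (v w : ℂ) : (conj v * w).re ≤ (‖v‖ ^ 2 + ‖w‖ ^ 2) / 2 := by
  simp only [← Complex.normSq_eq_norm_sq, Complex.normSq_apply, Complex.mul_re, Complex.conj_re,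
    Complex.conj_im]
  nlinarith [sq_nonneg (v.re - w.re), sq_nonneg (v.im - w.im)]

/-- The contraction property in its bilinear form. -/
theorem IsSchur.sum_re_conj_mul_le {F : ℂ → ℂ} (hF : IsSchur F) (N : ℕ) (u : PowerSeries ℂ)
    (v : ℕ → ℂ) :
    ∑ n ∈ Finset.range N, (conj (v n) * coeff n (taylorPS F * u)).re ≤
      (∑ n ∈ Finset.range N, ‖v n‖ ^ 2 + ∑ n ∈ Finset.range N, ‖coeff n u‖ ^ 2) / 2 := by
  have h1 := hF.truncNormSq_mul_le N u
  simp only [truncNormSq] at h1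
  have h2 := Finset.sum_le_sum fun n (_ : n ∈ Finset.range N) =>
    re_conj_mul_le (v n) (coeff n (taylorPS F * u))
  rw [← Finset.sum_div, Finset.sum_add_distrib] at h2
  linarith

theorem exists_norm_one_conj_mul (w : ℂ) : ∃ θ : ℂ, ‖θ‖ = 1 ∧ conj θ * w = ‖w‖ := by
  rcases eq_or_ne w 0 with rfl | hw
  · exact ⟨1, by simp, by simp⟩
  · have hn : (‖w‖ : ℂ) ≠ 0 := by simpa using hw
    refine ⟨w / ‖w‖, by simp [hw], ?_⟩
    rw [map_div₀, Complex.conj_ofReal, div_mul_eq_mul_div, ← Complex.normSq_eq_conj_mul_self,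
      Complex.normSq_eq_norm_sq]
    push_cast
    field_simp

/-! ### Carlson's coefficient inequalities -/

/-- A common form of Carlson's coefficient inequalities. -/
theorem IsSchur.norm_taylorCoeff_add_sum_le {F : ℂ → ℂ} (hF : IsSchur F) {N : ℕ} (hN : N ≠ 0)
    (τ : ℕ → ℝ) (hτ : ∀ j, N < 2 * j → τ j = 0) :
    ‖taylorCoeff F N‖ + ∑ i ∈ Finset.range N,
      (2 * τ i - τ i ^ 2 - if 2 * i = N then ‖taylorCoeff F 0‖ * τ i ^ 2 else 0) *
        ‖taylorCoeff F i‖ ^ 2 ≤ 1 := by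
  obtain ⟨θ, hθ, hθa⟩ := exists_norm_one_conj_mul (taylorCoeff F N)
  set a := taylorCoeff F with ha
  have hτN : τ N = 0 := hτ N (by omega)
  -- The reflection makes the N-th coefficient of F·U equal to Σ τ_i|a_i|². Since τ lives on indices
  -- ≤ N/2, U starts in degree ≥ N/2, so among the i where τ_i can be nonzero it affects only i =
  -- N/2; that cross term costs |a₀|τ_i²|a_i|².
  set U : PowerSeries ℂ := PowerSeries.mk fun q => τ (N - q) * conj (a (N - q)) with hU
  have key := hF.sum_re_conj_mul_le (N + 1) (1 + PowerSeries.C θ * U)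
    (fun i => if i = N then θ else τ i * a i)
  have hUc : ∀ q, 2 * q < N → coeff q U = 0 := fun q hq => by
    simp [hU, hτ (N - q) (by omega)]
  have hnorm : ∑ q ∈ Finset.range (N + 1), ‖coeff q (1 + PowerSeries.C θ * U)‖ ^ 2 =
      1 + ∑ i ∈ Finset.range N, τ i ^ 2 * ‖a i‖ ^ 2 := by
    have h1 : ∀ q, ‖coeff q (1 + PowerSeries.C θ * U)‖ ^ 2 =
        (if q = 0 then 1 else 0) + τ (N - q) ^ 2 * ‖a (N - q)‖ ^ 2 := by
      intro q
      rw [map_add, PowerSeries.coeff_C_mul, PowerSeries.coeff_one]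
      split_ifs with h
      · subst h
        rw [hUc 0 (by omega)]
        simp [hτN]
      · simp [hU, hθ, mul_pow]
    simp only [h1, Finset.sum_add_distrib, Finset.sum_ite_eq']
    rw [if_pos (by simp)]
    congr 1
    have h2 := Finset.sum_range_reflect (fun i => τ i ^ 2 * ‖a i‖ ^ 2) (N + 1)
    rw [Finset.sum_range_succ (fun i => τ i ^ 2 * ‖a i‖ ^ 2), hτN] at h2
    simpa using h2
  have hv : ∑ i ∈ Finset.range (N + 1), ‖(if i = N then θ else τ i * a i)‖ ^ 2 =
      1 + ∑ i ∈ Finset.range N, τ i ^ 2 * ‖a i‖ ^ 2 := by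
    rw [Finset.sum_range_succ, if_pos rfl, hθ, add_comm, one_pow]
    congr 1
    refine Finset.sum_congr rfl fun i hi => ?_
    rw [if_neg (Finset.mem_range.1 hi).ne]
    simp [mul_pow]
  have hc : ∀ i, coeff i (taylorPS F * (1 + PowerSeries.C θ * U)) =
      a i + θ * coeff i (taylorPS F * U) := by
    intro i
    rw [mul_add, mul_one, mul_left_comm, map_add, PowerSeries.coeff_C_mul, coeff_taylorPS]
  have hcN : coeff N (taylorPS F * U) = ((∑ i ∈ Finset.range N, τ i * ‖a i‖ ^ 2 : ℝ) : ℂ) := by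
    rw [PowerSeries.coeff_mul, Finset.Nat.sum_antidiagonal_eq_sum_range_succ_mk,
      Finset.sum_range_succ]
    rw [Nat.sub_self, hUc 0 (by omega), mul_zero, add_zero, Complex.ofReal_sum]
    refine Finset.sum_congr rfl fun i hi => ?_
    have : N - (N - i) = i := by have := Finset.mem_range.1 hi; omega
    simp only [coeff_taylorPS, hU, PowerSeries.coeff_mk, this]
    push_cast
    rw [← Complex.conj_mul']
    ring
  have hlt : ∀ i ∈ Finset.range N,
      (τ i - if 2 * i = N then ‖a 0‖ * τ i ^ 2 else 0) * ‖a i‖ ^ 2 ≤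
        (conj (if i = N then θ else τ i * a i) *
          coeff i (taylorPS F * (1 + PowerSeries.C θ * U))).re := by
    intro i hi
    have hiN := Finset.mem_range.1 hi
    rw [if_neg hiN.ne, hc]
    by_cases h0 : N < 2 * i
    · simp [hτ i h0]
    have hci : coeff i (taylorPS F * U) = if 2 * i = N then a 0 * (τ i * conj (a i)) else 0 := by
      rw [PowerSeries.coeff_mul]
      split_ifs with h2
      · rw [Finset.sum_eq_single (0, i)]
        · simp [hU, ha, show N - i = i by omega]
        · rintro ⟨p, q⟩ hpq hne
          rw [Finset.HasAntidiagonal.mem_antidiagonal] at hpq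
          have : q ≠ i := by rintro rfl; exact hne (by simp at hpq ⊢; omega)
          rw [hUc q (by dsimp at hpq ⊢; omega), mul_zero]
        · simp
      · refine Finset.sum_eq_zero ?_
        rintro ⟨p, q⟩ hpq
        rw [Finset.HasAntidiagonal.mem_antidiagonal] at hpq
        rw [hUc q (by dsimp at hpq ⊢; omega), mul_zero]
    rw [hci, mul_add, Complex.add_re]
    have e1 : (conj ((τ i : ℂ) * a i) * a i).re = τ i * ‖a i‖ ^ 2 := by
      rw [map_mul, Complex.conj_ofReal, mul_assoc, Complex.conj_mul', ← Complex.ofReal_pow,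
        ← Complex.ofReal_mul, Complex.ofReal_re]
    rw [e1]
    split_ifs with h2
    · have h3 := Complex.abs_re_le_norm
        (conj ((τ i : ℂ) * a i) * (θ * (a 0 * (τ i * conj (a i)))))
      have h4 : ‖conj ((τ i : ℂ) * a i) * (θ * (a 0 * (τ i * conj (a i))))‖ =
          ‖a 0‖ * τ i ^ 2 * ‖a i‖ ^ 2 := by
        simp only [norm_mul, RCLike.norm_conj, hθ, Complex.norm_real, Real.norm_eq_abs]
        rw [← sq_abs (τ i)]
        ring
      rw [h4] at h3
      linarith [neg_abs_le (conj ((τ i : ℂ) * a i) * (θ * (a 0 * (τ i * conj (a i))))).re]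
    · simp
  have hN1 : (conj (if N = N then θ else τ N * a N) *
      coeff N (taylorPS F * (1 + PowerSeries.C θ * U))).re =
      ‖a N‖ + ∑ i ∈ Finset.range N, τ i * ‖a i‖ ^ 2 := by
    rw [if_pos rfl, hc, mul_add, hθa, hcN, ← mul_assoc, Complex.conj_mul', hθ]
    simp only [Complex.ofReal_one, one_pow, one_mul, ← Complex.ofReal_add, Complex.ofReal_re]
  rw [hnorm, hv, Finset.sum_range_succ, hN1] at key
  have h5 := Finset.sum_le_sum hlt
  have h6 : ∑ i ∈ Finset.range N,
      (2 * τ i - τ i ^ 2 - if 2 * i = N then ‖a 0‖ * τ i ^ 2 else 0) * ‖a i‖ ^ 2 =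
      ∑ i ∈ Finset.range N, (τ i - if 2 * i = N then ‖a 0‖ * τ i ^ 2 else 0) * ‖a i‖ ^ 2 +
      ∑ i ∈ Finset.range N, τ i * ‖a i‖ ^ 2 - ∑ i ∈ Finset.range N, τ i ^ 2 * ‖a i‖ ^ 2 := by
    rw [← Finset.sum_add_distrib, ← Finset.sum_sub_distrib]
    exact Finset.sum_congr rfl fun i _ => by ring
  rw [h6]
  linarith

/-- Carlson's inequality for the coefficients with odd index. -/
theorem IsSchur.norm_taylorCoeff_odd_le {F : ℂ → ℂ} (hF : IsSchur F) (n : ℕ) :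
    ‖taylorCoeff F (2 * n + 1)‖ + ∑ j ∈ Finset.range (n + 1), ‖taylorCoeff F j‖ ^ 2 ≤ 1 := by
  have h := hF.norm_taylorCoeff_add_sum_le (N := 2 * n + 1) (by omega)
    (fun i => if i < n + 1 then 1 else 0) (fun j hj => if_neg (by omega))
  convert h using 2
  rw [← Finset.sum_subset (Finset.range_mono (show n + 1 ≤ 2 * n + 1 by omega))]
  · refine Finset.sum_congr rfl fun i hi => ?_
    rw [if_pos (Finset.mem_range.1 hi), if_neg (by omega)]
    ring
  · intro i _ hi
    rw [if_neg (by simpa using hi), if_neg (by omega)]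
    ring

/-- Carlson's inequality for the coefficients with even index. -/
theorem IsSchur.norm_taylorCoeff_even_le {F : ℂ → ℂ} (hF : IsSchur F) {n : ℕ} (hn : n ≠ 0) :
    ‖taylorCoeff F (2 * n)‖ + (∑ j ∈ Finset.range n, ‖taylorCoeff F j‖ ^ 2 +
      1 / (1 + ‖taylorCoeff F 0‖) * ‖taylorCoeff F n‖ ^ 2) ≤ 1 := by
  have hp : 1 + ‖taylorCoeff F 0‖ ≠ 0 := by positivity
  have h := hF.norm_taylorCoeff_add_sum_le (N := 2 * n) (by omega)
    -- The middle value maximises 2τ - (1+|a₀|)τ².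
    (fun i => if i < n then 1 else if i = n then 1 / (1 + ‖taylorCoeff F 0‖) else 0)
    (fun j hj => by rw [if_neg (by omega), if_neg (by omega)])
  convert h using 2
  rw [← Finset.sum_subset (Finset.range_mono (show n + 1 ≤ 2 * n by omega)),
    Finset.sum_range_succ]
  · congr 1
    · refine Finset.sum_congr rfl fun i hi => ?_
      have := Finset.mem_range.1 hi
      rw [if_pos this, if_neg (by omega)]
      ring
    · rw [if_neg (lt_irrefl n), if_pos rfl, if_pos rfl]
      field_simp
      ring
  · intro i _ hi
    rw [Finset.mem_range] at hi
    rw [if_neg (by omega), if_neg (by omega), if_neg (by omega)]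
    ring

theorem IsSchur.sum_succ_sq_le {F : ℂ → ℂ} (hF : IsSchur F) (N : ℕ) :
    ∑ n ∈ Finset.range N, ‖taylorCoeff F (n + 1)‖ ^ 2 ≤ 1 - ‖taylorCoeff F 0‖ ^ 2 := by
  have h := hF.sum_sq_le_one (N + 1)
  rw [Finset.sum_range_succ'] at h
  linarith

theorem IsSchur.norm_taylorCoeff_succ_le {F : ℂ → ℂ} (hF : IsSchur F) (n : ℕ) :
    ‖taylorCoeff F (n + 1)‖ ≤ 1 - ‖taylorCoeff F 0‖ ^ 2 := by
  have key : ∀ m, 0 < m → ‖taylorCoeff F 0‖ ^ 2 ≤ ∑ j ∈ Finset.range m, ‖taylorCoeff F j‖ ^ 2 :=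
    fun m hm => Finset.single_le_sum (f := fun j => ‖taylorCoeff F j‖ ^ 2)
      (fun _ _ => by positivity) (Finset.mem_range.2 hm)
  obtain ⟨m, hm | hm⟩ := Nat.even_or_odd' (n + 1)
  · rw [hm]
    have h := hF.norm_taylorCoeff_even_le (n := m) (by omega)
    have h2 : 0 ≤ 1 / (1 + ‖taylorCoeff F 0‖) * ‖taylorCoeff F m‖ ^ 2 := by positivity
    linarith [key m (by omega)]
  · rw [hm]
    have h := hF.norm_taylorCoeff_odd_le m
    linarith [key (m + 1) (by omega)]

/-! ### The refined Bohr inequality -/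

/-- The two summands match how |a_m|² enters Carlson's inequalities: with factor 1/(1+a) at index
2m, and with factor 1 at every later index, where the powers of r sum to r^(2m) · r/(1-r). -/
theorem weight_eq {a r : ℝ} (ha : 0 ≤ a) (hr1 : r < 1) :
    1 / (1 + a) * ((1 + a * r) / (1 - r)) = 1 / (1 + a) + r / (1 - r) := by
  have h1 : 1 - r ≠ 0 := by linarith
  have h2 : 1 + a ≠ 0 := by positivity
  field_simp
  ring

/-- The refined Bohr inequality for Schur functions. -/
theorem IsSchur.refined_bohr {F : ℂ → ℂ} (hF : IsSchur F) {r : ℝ} (hr0 : 0 ≤ r) (hr1 : r < 1)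
    (N : ℕ) :
    ∑ n ∈ Finset.range N, ‖taylorCoeff F (n + 1)‖ * r ^ (n + 1) +
      1 / (1 + ‖taylorCoeff F 0‖) * ((1 + ‖taylorCoeff F 0‖ * r) / (1 - r)) *
        ∑ n ∈ Finset.range N, ‖taylorCoeff F (n + 1)‖ ^ 2 * r ^ (2 * (n + 1)) ≤
      (1 - ‖taylorCoeff F 0‖ ^ 2) * (r / (1 - r)) := by
  rw [weight_eq (norm_nonneg _) hr1]
  set A : ℕ → ℝ := fun n => ‖taylorCoeff F (n + 1)‖ with hA
  set e := 1 / (1 + ‖taylorCoeff F 0‖) with he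
  set a := ‖taylorCoeff F 0‖ with ha
  have h1r : 0 < 1 - r := by linarith
  have hA0 : ∀ n, 0 ≤ A n := fun n => norm_nonneg _
  -- Equivalently, after 2N coefficients an allowance of (1 - a² - Σ_{n<N} A_n²) r^(2N+1)/(1-r) is
  -- still left; it is nonnegative and is dropped at the end.
  have hind : ∀ N : ℕ, ∑ n ∈ Finset.range (2 * N), A n * r ^ (n + 1) +
      (e + r / (1 - r)) * ∑ n ∈ Finset.range N, A n ^ 2 * r ^ (2 * (n + 1)) -
      (∑ n ∈ Finset.range N, A n ^ 2) * (r ^ (2 * N + 1) / (1 - r)) ≤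
      (1 - a ^ 2) * ((r - r ^ (2 * N + 1)) / (1 - r)) := by
    intro N
    induction N with
    | zero => simp
    | succ N ih =>
      have ho := hF.norm_taylorCoeff_odd_le N
      have hev := hF.norm_taylorCoeff_even_le (n := N + 1) (by omega)
      rw [Finset.sum_range_succ'] at ho hev
      rw [← he] at hev
      change A (2 * N) + (∑ j ∈ Finset.range N, A j ^ 2 + a ^ 2) ≤ 1 at ho
      change A (2 * N + 1) + (∑ j ∈ Finset.range N, A j ^ 2 + a ^ 2 + e * A N ^ 2) ≤ 1 at hev
      rw [show 2 * (N + 1) = 2 * N + 1 + 1 by ring, Finset.sum_range_succ _ (2 * N + 1),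
        Finset.sum_range_succ _ (2 * N), Finset.sum_range_succ _ N, Finset.sum_range_succ _ N,
        show 2 * (N + 1) = 2 * N + 1 + 1 by ring]
      set s := ∑ j ∈ Finset.range N, A j ^ 2
      set R := r ^ (2 * N + 1) with hR
      have hR0 : 0 ≤ R := by positivity
      have e1 : r ^ (2 * N + 1 + 1) = R * r := by rw [hR]; ring
      have e2 : r ^ (2 * N + 1 + 1 + 1) = R * r ^ 2 := by rw [hR]; ring
      rw [e1, e2]
      have k1 := mul_le_mul_of_nonneg_right ho hR0
      have k2 := mul_le_mul_of_nonneg_right hev (mul_nonneg hR0 hr0)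
      have e3 : R * r ^ 2 / (1 - r) = R / (1 - r) - R * (1 + r) := by
        field_simp; ring
      have e4 : (r - R * r ^ 2) / (1 - r) = (r - R) / (1 - r) + R * (1 + r) := by
        field_simp; ring
      have e5 : A N ^ 2 * (R * r ^ 2 / (1 - r)) = r / (1 - r) * (A N ^ 2 * (R * r)) := by ring
      rw [e4, add_mul _ _ (R * r ^ 2 / (1 - r)), e5, e3]
      linarith
  have h1 := hind N
  have hmono : ∑ n ∈ Finset.range N, A n * r ^ (n + 1) ≤
      ∑ n ∈ Finset.range (2 * N), A n * r ^ (n + 1) :=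
    Finset.sum_le_sum_of_subset_of_nonneg (Finset.range_mono (by omega))
      fun n _ _ => mul_nonneg (hA0 n) (by positivity)
  have h2 : (∑ n ∈ Finset.range N, A n ^ 2) * (r ^ (2 * N + 1) / (1 - r)) ≤
      (1 - a ^ 2) * (r ^ (2 * N + 1) / (1 - r)) :=
    mul_le_mul_of_nonneg_right (hF.sum_succ_sq_le N) (by positivity)
  rw [sub_div, mul_sub] at h1
  linarith

/-! ### Weighted ℓ² inequalities by Abel summation -/

/-- Abel summation: inequalities between partial sums persist under nonnegative antitone
weights. -/
theorem sum_mul_le_sum_mul_of_antitone {x y u : ℕ → ℝ} (hu : Antitone u) (hu0 : ∀ n, 0 ≤ u n)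
    (hxy : ∀ N, ∑ n ∈ Finset.range N, x n ≤ ∑ n ∈ Finset.range N, y n) (N : ℕ) :
    ∑ n ∈ Finset.range N, u n * x n ≤ ∑ n ∈ Finset.range N, u n * y n := by
  have key : ∀ N, u N * ∑ n ∈ Finset.range (N + 1), (y n - x n) ≤
      ∑ n ∈ Finset.range (N + 1), u n * (y n - x n) := by
    intro N
    induction N with
    | zero => simp
    | succ N ih =>
      rw [Finset.sum_range_succ, Finset.sum_range_succ (fun n => u n * (y n - x n)), mul_add]
      have h1 : 0 ≤ ∑ n ∈ Finset.range (N + 1), (y n - x n) := by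
        rw [Finset.sum_sub_distrib]; linarith [hxy (N + 1)]
      have := mul_le_mul_of_nonneg_right (hu N.le_succ) h1
      linarith
  cases N with
  | zero => simp
  | succ N =>
    have h1 : 0 ≤ ∑ n ∈ Finset.range (N + 1), (y n - x n) := by
      rw [Finset.sum_sub_distrib]; linarith [hxy (N + 1)]
    have h2 := (mul_nonneg (hu0 N) h1).trans (key N)
    simp only [mul_sub, Finset.sum_sub_distrib] at h2
    linarith

/-- The Schur step writes F(0) - F as zψ(1 - conj(F(0))F), so contraction bounds the partial sums of
|a_{n+1}|² by those of (1-|a₀|²)², |a₀|²|a₁|², |a₀|²|a₂|², …. With weights ρ^(n+1) the right side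
reproduces |a₀|²ρ times the left sum, which is then absorbed. -/
theorem IsSchur.sum_sq_mul_pow_le {F : ℂ → ℂ} (hF : IsSchur F) {ρ : ℝ} (hρ0 : 0 ≤ ρ)
    (hρ1 : ρ ≤ 1) (N : ℕ) :
    (1 - ‖taylorCoeff F 0‖ ^ 2 * ρ) *
      ∑ n ∈ Finset.range N, ‖taylorCoeff F (n + 1)‖ ^ 2 * ρ ^ (n + 1) ≤
      (1 - ‖taylorCoeff F 0‖ ^ 2) ^ 2 * ρ := by
  have hL : ∀ N, ∑ n ∈ Finset.range N, ‖taylorCoeff F (n + 1)‖ ^ 2 ≤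
      ∑ n ∈ Finset.range N, (if n = 0 then (1 - ‖taylorCoeff F 0‖ ^ 2) ^ 2 else
        ‖taylorCoeff F 0‖ ^ 2 * ‖taylorCoeff F n‖ ^ 2) := by
    intro N
    rcases hF.norm_zero_le.lt_or_eq with h1 | h1
    · obtain ⟨ψ, hψ, e⟩ := hF.exists_schur_step h1
      have h2 := hψ.truncNormSq_mul_le N (1 - PowerSeries.C (conj (F 0)) * taylorPS F)
      rw [← truncNormSq_X_mul, ← mul_assoc, ← e] at h2
      rw [truncNormSq, Finset.sum_range_succ'] at h2
      simp only [truncNormSq, map_sub, PowerSeries.coeff_C_mul, coeff_taylorPS,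
        PowerSeries.coeff_C, taylorCoeff_zero, PowerSeries.coeff_one] at h2
      simp only [Nat.succ_ne_zero, if_false, if_true, zero_sub, norm_neg, sub_self, norm_zero] at h2
      refine le_of_eq_of_le (by simp) (h2.trans_eq (Finset.sum_congr rfl fun n _ => ?_))
      split_ifs with hn
      · subst hn
        rw [taylorCoeff_zero, Complex.conj_mul', ← Complex.ofReal_pow, ← Complex.ofReal_one,
          ← Complex.ofReal_sub, Complex.norm_real, Real.norm_eq_abs, sq_abs]
      · rw [zero_sub, norm_neg, norm_mul, RCLike.norm_conj, mul_pow, taylorCoeff_zero]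
    · have h3 := hF.sum_succ_sq_le N
      rw [taylorCoeff_zero, h1] at h3
      refine (h3.trans_eq (by norm_num)).trans (Finset.sum_nonneg fun n _ => ?_)
      split_ifs <;> positivity
  have hA := sum_mul_le_sum_mul_of_antitone (u := fun n => ρ ^ (n + 1))
    (fun m n hmn => pow_le_pow_of_le_one hρ0 hρ1 (by omega)) (fun n => by positivity) hL N
  have hmono : ∀ n, 0 ≤ ‖taylorCoeff F (n + 1)‖ ^ 2 * ρ ^ (n + 1) := fun n => by positivity
  have e1 : ∑ n ∈ Finset.range N, ρ ^ (n + 1) * ‖taylorCoeff F (n + 1)‖ ^ 2 =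
      ∑ n ∈ Finset.range N, ‖taylorCoeff F (n + 1)‖ ^ 2 * ρ ^ (n + 1) :=
    Finset.sum_congr rfl fun n _ => mul_comm _ _
  rw [e1] at hA
  cases N with
  | zero => simp; positivity
  | succ N =>
    rw [Finset.sum_range_succ' (fun n => ρ ^ (n + 1) * ite _ _ _)] at hA
    have e2 : ∑ n ∈ Finset.range N, ρ ^ (n + 1 + 1) * (if n + 1 = 0 then
        (1 - ‖taylorCoeff F 0‖ ^ 2) ^ 2 else ‖taylorCoeff F 0‖ ^ 2 * ‖taylorCoeff F (n + 1)‖ ^ 2) =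
        ‖taylorCoeff F 0‖ ^ 2 * ρ *
          ∑ n ∈ Finset.range N, ‖taylorCoeff F (n + 1)‖ ^ 2 * ρ ^ (n + 1) := by
      rw [Finset.mul_sum]
      refine Finset.sum_congr rfl fun n _ => ?_
      rw [if_neg n.succ_ne_zero]
      ring
    rw [e2, if_pos rfl] at hA
    have h3 : ∑ n ∈ Finset.range N, ‖taylorCoeff F (n + 1)‖ ^ 2 * ρ ^ (n + 1) ≤
        ∑ n ∈ Finset.range (N + 1), ‖taylorCoeff F (n + 1)‖ ^ 2 * ρ ^ (n + 1) :=
      Finset.sum_le_sum_of_subset_of_nonneg (Finset.range_mono N.le_succ) fun n _ _ => hmono n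
    have h4 := mul_le_mul_of_nonneg_left h3 (mul_nonneg (sq_nonneg ‖taylorCoeff F 0‖) hρ0)
    simp only [zero_add, pow_one] at hA
    linarith

/-- The weights `ρ ^ (n + 1) / (n + 1) ^ 2` transfer an `ℓ²` comparison of derivatives to the
functions themselves. -/
theorem sum_sq_mul_pow_le_of_deriv {α β : ℕ → ℝ}
    (hL : ∀ N, ∑ n ∈ Finset.range N, ((n + 1) * β n) ^ 2 ≤
      ∑ n ∈ Finset.range N, ((n + 1) * α n) ^ 2) {ρ : ℝ} (hρ0 : 0 ≤ ρ) (hρ1 : ρ ≤ 1) (N : ℕ) :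
    ∑ n ∈ Finset.range N, β n ^ 2 * ρ ^ (n + 1) ≤ ∑ n ∈ Finset.range N, α n ^ 2 * ρ ^ (n + 1) := by
  have h := sum_mul_le_sum_mul_of_antitone (u := fun n => ρ ^ (n + 1) / ((n : ℝ) + 1) ^ 2)
    (fun m n hmn => div_le_div₀ (by positivity) (pow_le_pow_of_le_one hρ0 hρ1 (by omega))
      (by positivity) (by gcongr)) (fun n => by positivity) hL N
  have e : ∀ γ : ℕ → ℝ, ∑ n ∈ Finset.range N, ρ ^ (n + 1) / ((n : ℝ) + 1) ^ 2 *
      ((n + 1) * γ n) ^ 2 = ∑ n ∈ Finset.range N, γ n ^ 2 * ρ ^ (n + 1) := by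
    intro γ
    refine Finset.sum_congr rfl fun n _ => ?_
    have : (n : ℝ) + 1 ≠ 0 := by positivity
    field_simp
  rwa [e, e] at h

/-! ### Comparison of majorants when the derivative is multiplied by a Schur function -/

theorem sum_pow_succ_le {x : ℝ} (hx0 : 0 ≤ x) (hx1 : x < 1) (N : ℕ) :
    ∑ n ∈ Finset.range N, x ^ n ≤ 1 / (1 - x) := by
  rw [one_div, ← tsum_geometric_of_lt_one hx0 hx1]
  exact (summable_geometric_of_lt_one hx0 hx1).sum_le_tsum _ fun n _ => by positivity

/-- AM-GM against the extremal sequence a^n bounds the linear sum by r/(1-ar), through `hρ` at ρ =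
r/a, which is admissible because r < a. The quadratic sum uses ρ = r², and the two bounds add up to
exactly r/(1-r). -/
theorem majorant_le_of_lt {α β : ℕ → ℝ} {a r : ℝ} (ha1 : a < 1)
    (hr0 : 0 < r) (hra : r < a)
    (hL : ∀ N, ∑ n ∈ Finset.range N, ((n + 1) * β n) ^ 2 ≤
      ∑ n ∈ Finset.range N, ((n + 1) * α n) ^ 2)
    (hρ : ∀ ρ, 0 ≤ ρ → ρ ≤ 1 → ∀ N,
      (1 - a ^ 2 * ρ) * ∑ n ∈ Finset.range N, α n ^ 2 * ρ ^ (n + 1) ≤ ρ) (N : ℕ) :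
    ∑ n ∈ Finset.range N, β n * r ^ (n + 1) + (1 - a) * (1 + a * r) / (1 - r) *
      ∑ n ∈ Finset.range N, β n ^ 2 * r ^ (2 * (n + 1)) ≤ r / (1 - r) := by
  have ha0 : 0 < a := hr0.trans hra
  have h1r : 0 < 1 - r := by linarith
  have har : 0 < 1 - a * r := by nlinarith
  have h1 : ∀ n, β n * r ^ (n + 1) ≤
      (r * (a * r) ^ n + a * (β n ^ 2 * (r / a) ^ (n + 1))) / 2 := by
    intro n
    have hp : 0 < r ^ (n + 1) / a ^ n := by positivity
    have e1 : r * (a * r) ^ n = (a ^ n) ^ 2 * (r ^ (n + 1) / a ^ n) := by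
      rw [mul_pow]; field_simp; ring
    have e2 : a * (β n ^ 2 * (r / a) ^ (n + 1)) = β n ^ 2 * (r ^ (n + 1) / a ^ n) := by
      rw [div_pow]; field_simp; ring
    have e3 : β n * r ^ (n + 1) = a ^ n * β n * (r ^ (n + 1) / a ^ n) := by
      field_simp
    rw [e1, e2, e3]
    nlinarith [mul_nonneg (sq_nonneg (a ^ n - β n)) hp.le]
  have h2 := Finset.sum_le_sum fun n (_ : n ∈ Finset.range N) => h1 n
  rw [← Finset.sum_div, Finset.sum_add_distrib, ← Finset.mul_sum, ← Finset.mul_sum] at h2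
  have h3 := sum_pow_succ_le (mul_nonneg ha0.le hr0.le) (by linarith : a * r < 1) N
  have hra1 : r / a ≤ 1 := (div_le_one ha0).2 hra.le
  have h4 := hρ (r / a) (by positivity) hra1 N
  have e4 : 1 - a ^ 2 * (r / a) = 1 - a * r := by field_simp
  rw [e4] at h4
  have h5 := sum_sq_mul_pow_le_of_deriv hL (by positivity : 0 ≤ r / a) hra1 N
  have h6 : a * ∑ n ∈ Finset.range N, β n ^ 2 * (r / a) ^ (n + 1) ≤ r / (1 - a * r) := by
    rw [le_div_iff₀ har]
    have := mul_le_mul_of_nonneg_left h4 ha0.le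
    rw [mul_div_cancel₀ _ ha0.ne'] at this
    nlinarith [mul_le_mul_of_nonneg_left h5 (mul_nonneg ha0.le har.le)]
  have h7 := mul_le_mul_of_nonneg_left h3 hr0.le
  rw [mul_one_div] at h7
  have h8 : ∑ n ∈ Finset.range N, β n * r ^ (n + 1) ≤ r / (1 - a * r) := by linarith
  have hr2 : r ^ 2 ≤ 1 := by nlinarith
  have h9 := (sum_sq_mul_pow_le_of_deriv hL (sq_nonneg r) hr2 N)
  have h10 := hρ (r ^ 2) (sq_nonneg r) hr2 N
  simp only [← pow_mul] at h9 h10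
  have hp1 : 0 < 1 + a * r := by positivity
  have h11 : (1 + a * r) * ∑ n ∈ Finset.range N, β n ^ 2 * r ^ (2 * (n + 1)) ≤
      r ^ 2 / (1 - a * r) := by
    rw [le_div_iff₀ har]
    have e5 : (1 + a * r) * (1 - a * r) = 1 - a ^ 2 * r ^ 2 := by ring
    nlinarith [mul_le_mul_of_nonneg_left h9 (mul_pos hp1 har).le]
  have h12 := mul_le_mul_of_nonneg_left h11 (div_nonneg (by linarith : 0 ≤ 1 - a) h1r.le)
  have e6 : (1 - a) / (1 - r) * (r ^ 2 / (1 - a * r)) = r / (1 - r) - r / (1 - a * r) := by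
    field_simp
    ring
  have e7 : (1 - a) * (1 + a * r) / (1 - r) *
      ∑ n ∈ Finset.range N, β n ^ 2 * r ^ (2 * (n + 1)) = (1 - a) / (1 - r) *
      ((1 + a * r) * ∑ n ∈ Finset.range N, β n ^ 2 * r ^ (2 * (n + 1))) := by ring
  rw [e7]
  linarith

theorem sum_mul_pow_le_of_sum_sq_le {γ : ℕ → ℝ} {r : ℝ} (hr0 : 0 ≤ r) (hr : r ≤ 1 / 2) {N : ℕ}
    (hγ : ∑ n ∈ Finset.range (N + 1), γ n ^ 2 ≤ 4 / 3) :
    ∑ n ∈ Finset.range (N + 1), γ n * r ^ (n + 1) ≤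
      γ 0 * r + r ^ 2 * (41 / 30 - 5 / 8 * γ 0 ^ 2) := by
  rw [Finset.sum_range_succ'] at hγ ⊢
  -- This is xy ≤ (5/8)x² + (2/5)y². Then 41/30 = (5/8)(4/3) + (2/5)(4/3), the second 4/3 bounding
  -- 1/(1-r²).
  have h1 : ∀ n ∈ Finset.range N, γ (n + 1) * r ^ (n + 1 + 1) ≤
      r ^ 2 * (5 / 8 * γ (n + 1) ^ 2 + 2 / 5 * (r ^ 2) ^ n) := by
    intro n _
    have e : r ^ (n + 1 + 1) = r ^ 2 * r ^ n := by ring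
    have e2 : (r ^ 2) ^ n = (r ^ n) ^ 2 := by rw [← pow_mul, ← pow_mul, mul_comm]
    rw [e, e2, mul_left_comm]
    refine mul_le_mul_of_nonneg_left ?_ (sq_nonneg r)
    nlinarith [sq_nonneg (5 * γ (n + 1) - 4 * r ^ n)]
  have h2 := Finset.sum_le_sum h1
  rw [← Finset.mul_sum, Finset.sum_add_distrib, ← Finset.mul_sum, ← Finset.mul_sum] at h2
  have hr2 : r ^ 2 ≤ 1 / 4 := by nlinarith
  have h3 := sum_pow_succ_le (sq_nonneg r) (by linarith : r ^ 2 < 1) N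
  have h4 : 1 / (1 - r ^ 2) ≤ 4 / 3 := by
    rw [div_le_iff₀ (by linarith)]; linarith
  have h5 : r ^ 2 * (5 / 8 * ∑ n ∈ Finset.range N, γ (n + 1) ^ 2 +
      2 / 5 * ∑ n ∈ Finset.range N, (r ^ 2) ^ n) ≤ r ^ 2 * (41 / 30 - 5 / 8 * γ 0 ^ 2) :=
    mul_le_mul_of_nonneg_left (by linarith) (sq_nonneg r)
  simp only [zero_add, pow_one]
  linarith

/-- Dividing the convolution bound by n+1 leaves factors (j+1)/(n+1) ≤ 1 on the α_j with j < n. For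
j = 0 the factor is at most 1/2, which yields the saving α₀r/2 that later allows radii beyond 1/3.
-/
theorem majorant_le_bohr {α β : ℕ → ℝ} {c r : ℝ} (hα : ∀ n, 0 ≤ α n)
    (hc0 : 0 ≤ c) (hc1 : c ≤ 1) (hr0 : 0 ≤ r) (hr1 : r < 1)
    (hB : ∀ n : ℕ, (n + 1) * β n ≤
      c * ((n + 1) * α n) + (1 - c ^ 2) * ∑ j ∈ Finset.range n, (j + 1) * α j) (N : ℕ) :
    ∑ n ∈ Finset.range (N + 1), β n * r ^ (n + 1) ≤
      c * ∑ n ∈ Finset.range (N + 1), α n * r ^ (n + 1) + (1 - c ^ 2) * (r / (1 - r) *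
        (∑ n ∈ Finset.range (N + 1), α n * r ^ (n + 1) - α 0 * r / 2)) := by
  have h1r : 0 < 1 - r := by linarith
  have hc2 : 0 ≤ 1 - c ^ 2 := by nlinarith
  have hβ : ∀ n, β (n + 1) ≤ c * α (n + 1) +
      (1 - c ^ 2) * (∑ j ∈ Finset.range (n + 1), α j - α 0 / 2) := by
    intro n
    have h1 := hB (n + 1)
    have hn : (0 : ℝ) < ((n + 1 : ℕ) : ℝ) + 1 := by positivity
    have h2 : ∑ j ∈ Finset.range (n + 1), ((j : ℝ) + 1) * α j ≤
        (((n + 1 : ℕ) : ℝ) + 1) * (∑ j ∈ Finset.range (n + 1), α j - α 0 / 2) := by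
      rw [Finset.sum_range_succ', Finset.sum_range_succ' α]
      have h3 : ∑ j ∈ Finset.range n, (((j + 1 : ℕ) : ℝ) + 1) * α (j + 1) ≤
          (((n + 1 : ℕ) : ℝ) + 1) * ∑ j ∈ Finset.range n, α (j + 1) := by
        rw [Finset.mul_sum]
        refine Finset.sum_le_sum fun j hj => mul_le_mul_of_nonneg_right ?_ (hα _)
        have : j ≤ n := (Finset.mem_range.1 hj).le
        push_cast
        have : (j : ℝ) ≤ n := by exact_mod_cast this
        linarith
      have h4 : 0 ≤ (n : ℝ) * α 0 := mul_nonneg n.cast_nonneg (hα 0)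
      push_cast at h3 ⊢
      nlinarith
    have h5 := mul_le_mul_of_nonneg_left h2 hc2
    refine le_of_mul_le_mul_left (a := ((n + 1 : ℕ) : ℝ) + 1) ?_ hn
    linarith
  -- The extra term is the tail of the geometric series cut off at N; carrying it makes the
  -- induction exact.
  have hind : ∑ n ∈ Finset.range (N + 1), β n * r ^ (n + 1) +
      (1 - c ^ 2) * (r ^ (N + 2) / (1 - r) * (∑ j ∈ Finset.range (N + 1), α j - α 0 / 2)) ≤
      c * ∑ n ∈ Finset.range (N + 1), α n * r ^ (n + 1) + (1 - c ^ 2) * (r / (1 - r) *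
        (∑ n ∈ Finset.range (N + 1), α n * r ^ (n + 1) - α 0 * r / 2)) := by
    induction N with
    | zero =>
      have h0 := hB 0
      simp at h0
      have h1 := mul_le_mul_of_nonneg_right h0 hr0
      simp only [zero_add, Finset.sum_range_one, pow_one]
      have e : r ^ 2 / (1 - r) * (α 0 - α 0 / 2) = r / (1 - r) * (α 0 * r - α 0 * r / 2) := by ring
      rw [e]
      linarith
    | succ N ih =>
      rw [Finset.sum_range_succ _ (N + 1), Finset.sum_range_succ _ (N + 1),
        Finset.sum_range_succ _ (N + 1)]
      have h1 := mul_le_mul_of_nonneg_right (hβ N) (pow_nonneg hr0 (N + 2))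
      have e : r ^ (N + 1 + 2) / (1 - r) = r ^ (N + 2) / (1 - r) - r ^ (N + 2) := by
        field_simp; ring
      have e2 : r ^ (N + 1 + 2) / (1 - r) * α (N + 1) =
          r / (1 - r) * (α (N + 1) * r ^ (N + 2)) := by ring
      have e3 : r ^ (N + 1 + 2) / (1 - r) *
          (∑ j ∈ Finset.range (N + 1), α j + α (N + 1) - α 0 / 2) =
          r / (1 - r) * (α (N + 1) * r ^ (N + 2)) + (r ^ (N + 2) / (1 - r) - r ^ (N + 2)) *
            (∑ j ∈ Finset.range (N + 1), α j - α 0 / 2) := by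
        rw [← e, ← e2]; ring
      rw [e3, show N + 1 + 1 = N + 2 by ring]
      linarith
  have h6 : α 0 ≤ ∑ j ∈ Finset.range (N + 1), α j :=
    Finset.single_le_sum (fun j _ => hα j) (by simp)
  have h7 : 0 ≤ (1 - c ^ 2) *
      (r ^ (N + 2) / (1 - r) * (∑ j ∈ Finset.range (N + 1), α j - α 0 / 2)) :=
    mul_nonneg hc2 (mul_nonneg (by positivity) (by linarith [hα 0]))
  linarith

/-- Abel summation needs only the weight r⁴/4 at n = 0, the same as at n = 1 (hence `max n 1`). The
remaining weight r² - r⁴/4 is spent on the stronger pointwise bound β₀ ≤ cα₀. -/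
theorem sum_sq_mul_pow_le_sub {α β : ℕ → ℝ} {c r : ℝ} (hβ0 : 0 ≤ β 0) (hβα : β 0 ≤ c * α 0)
    (hr0 : 0 ≤ r) (hr1 : r ≤ 1)
    (hL : ∀ N, ∑ n ∈ Finset.range N, ((n + 1) * β n) ^ 2 ≤
      ∑ n ∈ Finset.range N, ((n + 1) * α n) ^ 2) (N : ℕ) :
    ∑ n ∈ Finset.range (N + 1), β n ^ 2 * r ^ (2 * (n + 1)) ≤
      ∑ n ∈ Finset.range (N + 1), α n ^ 2 * r ^ (2 * (n + 1)) -
        (1 - c ^ 2) * (α 0 ^ 2 * (r ^ 2 - r ^ 4 / 4)) := by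
  have h := sum_mul_le_sum_mul_of_antitone
    (u := fun n => r ^ (2 * (max n 1 + 1)) / ((max n 1 : ℕ) + 1 : ℝ) ^ 2)
    (fun m n hmn => div_le_div₀ (by positivity) (pow_le_pow_of_le_one hr0 hr1 (by omega))
      (by positivity) (by gcongr)) (fun n => by positivity) hL (N + 1)
  rw [Finset.sum_range_succ', Finset.sum_range_succ'] at h
  have e : ∀ γ : ℕ → ℝ, ∑ n ∈ Finset.range N, r ^ (2 * (max (n + 1) 1 + 1)) /
      ((max (n + 1) 1 : ℕ) + 1 : ℝ) ^ 2 * (((n + 1 : ℕ) + 1) * γ (n + 1)) ^ 2 =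
      ∑ n ∈ Finset.range N, γ (n + 1) ^ 2 * r ^ (2 * (n + 1 + 1)) := by
    intro γ
    refine Finset.sum_congr rfl fun n _ => ?_
    have h1 : max (n + 1) 1 = n + 1 := by omega
    have : ((n + 1 : ℕ) : ℝ) + 1 ≠ 0 := by positivity
    rw [h1]
    field_simp
  rw [e, e] at h
  rw [Finset.sum_range_succ', Finset.sum_range_succ']
  norm_num at h ⊢
  have h2 : β 0 ^ 2 ≤ c ^ 2 * α 0 ^ 2 := by
    rw [← mul_pow]; exact pow_le_pow_left₀ hβ0 hβα 2
  have h3 : 0 ≤ r ^ 2 - r ^ 4 / 4 := by nlinarith [pow_le_one₀ hr0 hr1 (n := 2), sq_nonneg r]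
  have := mul_le_mul_of_nonneg_right h2 h3
  linarith

/-- The two preceding bounds exceed the α-quantity by at most (1-c²)X - (1-c)M, so (1+c)X ≤ M
suffices. `hM` is the worst case c = 1, that is 2X ≤ M. -/
theorem majorant_le_of_bohr_radius {α β : ℕ → ℝ} {a c r : ℝ} (hα : ∀ n, 0 ≤ α n)
    (hβ0 : 0 ≤ β 0) (ha0 : 0 ≤ a) (ha1 : a < 1) (hc0 : 0 ≤ c) (hc1 : c ≤ 1)
    (hr0 : 0 ≤ r) (hr1 : r < 1)
    (hL : ∀ N, ∑ n ∈ Finset.range N, ((n + 1) * β n) ^ 2 ≤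
      ∑ n ∈ Finset.range N, ((n + 1) * α n) ^ 2)
    (hB : ∀ n : ℕ, (n + 1) * β n ≤
      c * ((n + 1) * α n) + (1 - c ^ 2) * ∑ j ∈ Finset.range n, (j + 1) * α j) (N : ℕ)
    (hF : ∑ n ∈ Finset.range (N + 1), α n * r ^ (n + 1) + (1 - a) * (1 + a * r) / (1 - r) *
      ∑ n ∈ Finset.range (N + 1), α n ^ 2 * r ^ (2 * (n + 1)) ≤ r / (1 - r))
    (hM : (3 * r - 1) * ∑ n ∈ Finset.range (N + 1), α n * r ^ (n + 1) ≤ α 0 * r ^ 2 +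
      2 * ((1 - a) * (1 + a * r)) * (α 0 ^ 2 * (r ^ 2 - r ^ 4 / 4))) :
    ∑ n ∈ Finset.range (N + 1), β n * r ^ (n + 1) + (1 - a) * (1 + a * r) / (1 - r) *
      ∑ n ∈ Finset.range (N + 1), β n ^ 2 * r ^ (2 * (n + 1)) ≤ r / (1 - r) := by
  have h1r : 0 < 1 - r := by linarith
  have h1 := majorant_le_bohr hα hc0 hc1 hr0 hr1 hB N
  have hb0 := hB 0
  simp at hb0
  have h2 := sum_sq_mul_pow_le_sub hβ0 hb0 hr0 hr1.le hL N
  have hM0 : 0 ≤ ∑ n ∈ Finset.range (N + 1), α n * r ^ (n + 1) :=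
    Finset.sum_nonneg fun n _ => mul_nonneg (hα n) (by positivity)
  set M := ∑ n ∈ Finset.range (N + 1), α n * r ^ (n + 1)
  set Λ := (1 - a) * (1 + a * r) / (1 - r) with hΛ
  have hΛ0 : 0 ≤ Λ := div_nonneg (mul_nonneg (by linarith) (by positivity)) h1r.le
  have h3 := mul_le_mul_of_nonneg_left h2 hΛ0
  set X := r / (1 - r) * (M - α 0 * r / 2) - Λ * (α 0 ^ 2 * (r ^ 2 - r ^ 4 / 4)) with hX
  have h4 : 2 * X ≤ M := by
    have e : 2 * X = (2 * r * M - α 0 * r ^ 2 -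
        2 * ((1 - a) * (1 + a * r)) * (α 0 ^ 2 * (r ^ 2 - r ^ 4 / 4))) / (1 - r) := by
      rw [hX, hΛ]; field_simp
    rw [e, div_le_iff₀ h1r]
    linarith
  have h5 : (1 + c) * X ≤ M := by
    rcases le_total 0 X with h | h
    · nlinarith
    · nlinarith
  have h6 := mul_le_mul_of_nonneg_left h5 (sub_nonneg.2 hc1)
  rw [hX] at h6
  linarith

/-- Main comparison: if the coefficients `α` obey the refined Bohr inequality and `β` is obtained
from `α` by multiplying the derivative with a Schur function, then `β` obeys the same bound for
`r ≤ 1 / 2`. -/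
theorem majorant_le {α β : ℕ → ℝ} {a c r : ℝ} (hα : ∀ n, 0 ≤ α n)
    (hβ0 : 0 ≤ β 0) (ha0 : 0 ≤ a) (ha1 : a < 1) (hc0 : 0 ≤ c) (hc1 : c ≤ 1)
    (hr0 : 0 ≤ r) (hr : r ≤ 1 / 2)
    (hF : ∀ N, ∑ n ∈ Finset.range N, α n * r ^ (n + 1) + (1 - a) * (1 + a * r) / (1 - r) *
      ∑ n ∈ Finset.range N, α n ^ 2 * r ^ (2 * (n + 1)) ≤ r / (1 - r))
    (hL : ∀ N, ∑ n ∈ Finset.range N, ((n + 1) * β n) ^ 2 ≤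
      ∑ n ∈ Finset.range N, ((n + 1) * α n) ^ 2)
    (hρ : ∀ ρ, 0 ≤ ρ → ρ ≤ 1 → ∀ N,
      (1 - a ^ 2 * ρ) * ∑ n ∈ Finset.range N, α n ^ 2 * ρ ^ (n + 1) ≤ ρ)
    (hB : ∀ n : ℕ, (n + 1) * β n ≤
      c * ((n + 1) * α n) + (1 - c ^ 2) * ∑ j ∈ Finset.range n, (j + 1) * α j) (N : ℕ) :
    ∑ n ∈ Finset.range N, β n * r ^ (n + 1) + (1 - a) * (1 + a * r) / (1 - r) *
      ∑ n ∈ Finset.range N, β n ^ 2 * r ^ (2 * (n + 1)) ≤ r / (1 - r) := by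
  have h1r : 0 < 1 - r := by linarith
  rcases hr0.eq_or_lt with rfl | hrpos
  · simp
  rcases lt_or_ge r a with hra | hra
  · exact majorant_le_of_lt ha1 hrpos hra hL hρ N
  cases N with
  | zero => simp; positivity
  | succ N =>
  -- Here a ≤ r ≤ 1/2, so 1/(1-a²) ≤ 4/3.
  have hα2 : ∑ n ∈ Finset.range (N + 1), α n ^ 2 ≤ 4 / 3 := by
    have h := hρ 1 zero_le_one le_rfl (N + 1)
    simp only [one_pow, mul_one] at h
    have ha2 : a ^ 2 ≤ 1 / 4 := by nlinarith
    have : 0 ≤ ∑ n ∈ Finset.range (N + 1), α n ^ 2 := Finset.sum_nonneg fun _ _ => sq_nonneg _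
    nlinarith
  have hβ2 : ∑ n ∈ Finset.range (N + 1), β n ^ 2 ≤ 4 / 3 := by
    have h := sum_sq_mul_pow_le_of_deriv hL zero_le_one le_rfl (N + 1)
    simp only [one_pow, mul_one] at h
    exact h.trans hα2
  have hM0 : 0 ≤ ∑ n ∈ Finset.range (N + 1), α n * r ^ (n + 1) :=
    Finset.sum_nonneg fun n _ => mul_nonneg (hα n) (by positivity)
  have hrsq : r ^ 2 ≤ 1 / 4 := by nlinarith
  have hr4 : 0 ≤ r ^ 2 - r ^ 4 / 4 := by
    linarith [mul_nonneg (sq_nonneg r) (by linarith : 0 ≤ 1 - r ^ 2 / 4)]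
  have hw0 : 0 ≤ (1 - a) * (1 + a * r) := mul_nonneg (by linarith) (by positivity)
  have hw : (1 - r) * (1 + r ^ 2) ≤ (1 - a) * (1 + a * r) := by
    have : 0 ≤ (r - a) * (1 - r + r * (a + r)) :=
      mul_nonneg (by linarith) (by positivity)
    linarith
  rcases le_or_gt r (1 / 3) with h3 | h3
  · refine majorant_le_of_bohr_radius hα hβ0 ha0 ha1 hc0 hc1 hr0 (by linarith) hL hB N (hF _) ?_
    refine (mul_nonpos_of_nonpos_of_nonneg (by linarith) hM0).trans ?_
    have := hα 0
    positivity
  -- For 1/3 < r ≤ 1/2, a large α₀ makes the savings in `hM` sufficient, while a small α₀ forces β₀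
  -- ≤ 7/10 and the ℓ² bound 4/3 suffices. The cut 7/10 works in both branches.
  rcases le_or_gt (7 / 10) (α 0) with h7 | h7
  · refine majorant_le_of_bohr_radius hα hβ0 ha0 ha1 hc0 hc1 hr0 (by linarith) hL hB N (hF _) ?_
    have h4 := mul_le_mul_of_nonneg_left (sum_mul_pow_le_of_sum_sq_le hr0 hr hα2)
      (by linarith : 0 ≤ 3 * r - 1)
    refine h4.trans ?_
    set y := α 0
    have hw2 : 5 / 8 ≤ (1 - a) * (1 + a * r) := by nlinarith [sq_nonneg (1 - 2 * r)]
    have hr5 : 15 / 16 * r ^ 2 ≤ r ^ 2 - r ^ 4 / 4 := by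
      linarith [mul_nonneg (sq_nonneg r) (by linarith : 0 ≤ 1 / 4 - r ^ 2)]
    have h5 : 75 / 64 * (y ^ 2 * r ^ 2) ≤
        2 * ((1 - a) * (1 + a * r)) * (y ^ 2 * (r ^ 2 - r ^ 4 / 4)) := by
      have e1 := mul_le_mul_of_nonneg_left hr5 (sq_nonneg y)
      have e2 := mul_le_mul hw2 e1 (by positivity) hw0
      linarith
    refine le_trans ?_ (add_le_add_right h5 _)
    have hy2 : (49 : ℝ) / 100 ≤ y ^ 2 := by nlinarith
    have h6 : 0 ≤ r * (y * (1 - 2 * r) - 41 / 30 * (r * (3 * r - 1)) +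
        y ^ 2 * (5 / 8 * (r * (3 * r - 1)) + 75 / 64 * r)) := by
      refine mul_nonneg hr0 ?_
      have h8 : 0 ≤ (y - 7 / 10) * (1 - 2 * r) := mul_nonneg (by linarith) (by linarith)
      have h9 : 0 ≤ (y ^ 2 - 49 / 100) * (5 / 8 * (r * (3 * r - 1)) + 75 / 64 * r) := by
        refine mul_nonneg (by linarith) (add_nonneg ?_ (by positivity))
        exact mul_nonneg (by norm_num) (mul_nonneg hr0 (by linarith))
      nlinarith [mul_nonneg (sub_nonneg.2 h3.le) (sub_nonneg.2 hr)]
    linarith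
  · have hb := hB 0
    simp at hb
    have hb7 : β 0 ≤ 7 / 10 := by nlinarith [hα 0]
    have h4 := sum_mul_pow_le_of_sum_sq_le hr0 hr hβ2
    have h5 : ∑ n ∈ Finset.range (N + 1), β n ^ 2 * r ^ (2 * (n + 1)) ≤
        β 0 ^ 2 * r ^ 2 + r ^ 4 * (4 / 3 - β 0 ^ 2) := by
      rw [Finset.sum_range_succ'] at hβ2 ⊢
      have h6 : ∑ n ∈ Finset.range N, β (n + 1) ^ 2 * r ^ (2 * (n + 1 + 1)) ≤
          ∑ n ∈ Finset.range N, r ^ 4 * β (n + 1) ^ 2 := by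
        refine Finset.sum_le_sum fun n _ => ?_
        rw [mul_comm]
        exact mul_le_mul_of_nonneg_right
          (pow_le_pow_of_le_one hr0 (by linarith) (by omega)) (sq_nonneg _)
      rw [← Finset.mul_sum] at h6
      have h7 := mul_le_mul_of_nonneg_left hβ2 (pow_nonneg hr0 4)
      simp only [zero_add, mul_one]
      linarith
    have hw1 : (1 - a) * (1 + a * r) ≤ 1 := by
      nlinarith [mul_nonneg ha0 h1r.le, mul_nonneg (sq_nonneg a) hr0]
    have h6 : (1 - a) * (1 + a * r) / (1 - r) *
        ∑ n ∈ Finset.range (N + 1), β n ^ 2 * r ^ (2 * (n + 1)) ≤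
        1 / (1 - r) * (β 0 ^ 2 * r ^ 2 + r ^ 4 * (4 / 3 - β 0 ^ 2)) :=
      mul_le_mul (div_le_div_of_nonneg_right hw1 h1r.le) h5
        (Finset.sum_nonneg fun n _ => by positivity) (by positivity)
    refine (add_le_add h4 h6).trans ?_
    rw [one_div_mul_eq_div, ← sub_nonneg]
    set b := β 0
    have e : r / (1 - r) - (b * r + r ^ 2 * (41 / 30 - 5 / 8 * b ^ 2) +
        (b ^ 2 * r ^ 2 + r ^ 4 * (4 / 3 - b ^ 2)) / (1 - r)) =
        r * (1 - (1 - r) * (b + r * (41 / 30 - 5 / 8 * b ^ 2)) - b ^ 2 * r -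
          r ^ 3 * (4 / 3 - b ^ 2)) / (1 - r) := by
      field_simp
      ring
    rw [e]
    refine div_nonneg (mul_nonneg hr0 ?_) h1r.le
    have hb2 : b ^ 2 ≤ 49 / 100 := by nlinarith
    have h8 : 0 ≤ (49 / 100 - b ^ 2) * (r * (1 - r) * (3 / 8 + r)) :=
      mul_nonneg (by linarith) (by positivity)
    have h9 : 0 ≤ (7 / 10 - b) * (1 - r) := mul_nonneg (by linarith) h1r.le
    have h10 : r ^ 3 ≤ r / 4 := by linarith [mul_nonneg hr0 (by linarith : 0 ≤ 1 / 4 - r ^ 2)]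
    linarith [sq_nonneg (1 - 2 * r)]

/-- If `F` and `ω` are Schur functions and `G' = ω F'`, then the Taylor coefficients `d` of `G`
satisfy the refined Bohr inequality of `F` for `r ≤ 1 / 2`. -/
theorem IsSchur.refined_bohr_of_deriv {F ω : ℂ → ℂ} (hF : IsSchur F) (hω : IsSchur ω) {d : ℕ → ℂ}
    (hd : ∀ n : ℕ, (n + 1) * d n = coeff n (taylorPS ω * taylorPS (deriv F))) {r : ℝ}
    (hr0 : 0 ≤ r) (hr : r ≤ 1 / 2) (N : ℕ) :
    ∑ n ∈ Finset.range N, ‖d n‖ * r ^ (n + 1) +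
      1 / (1 + ‖taylorCoeff F 0‖) * ((1 + ‖taylorCoeff F 0‖ * r) / (1 - r)) *
        ∑ n ∈ Finset.range N, ‖d n‖ ^ 2 * r ^ (2 * (n + 1)) ≤
      (1 - ‖taylorCoeff F 0‖ ^ 2) * (r / (1 - r)) := by
  have hcast : ∀ n : ℕ, ‖(n : ℂ) + 1‖ = n + 1 := fun n => by
    rw [← Nat.cast_succ, Complex.norm_natCast]; push_cast; ring
  have hnd : ∀ n : ℕ, ((n : ℝ) + 1) * ‖d n‖ = ‖coeff n (taylorPS ω * taylorPS (deriv F))‖ := by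
    intro n
    rw [← hd, norm_mul, hcast]
  have hnF : ∀ n : ℕ, ‖taylorCoeff (deriv F) n‖ = ((n : ℝ) + 1) * ‖taylorCoeff F (n + 1)‖ := by
    intro n
    rw [taylorCoeff_deriv, norm_mul, hcast]
  have hL : ∀ N, ∑ n ∈ Finset.range N, (((n : ℝ) + 1) * ‖d n‖) ^ 2 ≤
      ∑ n ∈ Finset.range N, (((n : ℝ) + 1) * ‖taylorCoeff F (n + 1)‖) ^ 2 := by
    intro N
    simpa [truncNormSq, hnd, hnF] using hω.truncNormSq_mul_le N (taylorPS (deriv F))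
  have hB : ∀ n : ℕ, ((n : ℝ) + 1) * ‖d n‖ ≤
      ‖taylorCoeff ω 0‖ * (((n : ℝ) + 1) * ‖taylorCoeff F (n + 1)‖) +
        (1 - ‖taylorCoeff ω 0‖ ^ 2) *
          ∑ j ∈ Finset.range n, ((j : ℝ) + 1) * ‖taylorCoeff F (j + 1)‖ := by
    intro n
    rw [hnd, mul_comm (taylorPS ω), PowerSeries.coeff_mul,
      Finset.Nat.sum_antidiagonal_eq_sum_range_succ_mk, Finset.sum_range_succ]
    simp only [coeff_taylorPS, Nat.sub_self]
    refine (norm_add_le _ _).trans ?_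
    rw [norm_mul, hnF, add_comm, mul_comm (_ * _) ‖taylorCoeff ω 0‖]
    gcongr
    rw [Finset.mul_sum]
    refine (norm_sum_le _ _).trans (Finset.sum_le_sum fun j hj => ?_)
    rw [norm_mul, hnF, mul_comm]
    have hj' := Finset.mem_range.1 hj
    obtain ⟨m, hm⟩ : ∃ m, n - j = m + 1 := ⟨n - j - 1, by omega⟩
    rw [hm]
    exact mul_le_mul_of_nonneg_right (hω.norm_taylorCoeff_succ_le m) (by positivity)
  have hω1 : ‖taylorCoeff ω 0‖ ≤ 1 := by rw [taylorCoeff_zero]; exact hω.norm_zero_le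
  have ha1 : ‖taylorCoeff F 0‖ ≤ 1 := by rw [taylorCoeff_zero]; exact hF.norm_zero_le
  have hrho := fun ρ h0 h1 N => hF.sum_sq_mul_pow_le (ρ := ρ) h0 h1 N
  have hbohr := hF.refined_bohr hr0 (by linarith : r < 1)
  have hsq := hF.sum_succ_sq_le N
  set A : ℕ → ℝ := fun n => ‖taylorCoeff F (n + 1)‖ with hA
  have hA0 : ∀ n, 0 ≤ A n := fun n => norm_nonneg _
  change ∀ N, ∑ n ∈ Finset.range N, (((n : ℝ) + 1) * ‖d n‖) ^ 2 ≤
      ∑ n ∈ Finset.range N, (((n : ℝ) + 1) * A n) ^ 2 at hL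
  have ha0 : 0 ≤ ‖taylorCoeff F 0‖ := norm_nonneg _
  set a := ‖taylorCoeff F 0‖ with ha
  have h1r : 0 < 1 - r := by linarith
  rcases ha1.lt_or_eq with ha1 | ha1
  -- Dividing all coefficients by 1 - a² brings the inequalities to the normalised form of
  -- `majorant_le`.
  · have hw : 0 < 1 - a ^ 2 := by nlinarith
    set w := 1 - a ^ 2 with hwdef
    have hΛ : w * (1 / (1 + a) * ((1 + a * r) / (1 - r))) = (1 - a) * (1 + a * r) / (1 - r) := by
      have : 1 + a ≠ 0 := by positivity
      rw [hwdef]; field_simp; ring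
    have e1 : ∀ (γ : ℕ → ℝ) (N : ℕ), ∑ n ∈ Finset.range N, γ n / w * r ^ (n + 1) =
        (∑ n ∈ Finset.range N, γ n * r ^ (n + 1)) / w := by
      intro γ N
      rw [Finset.sum_div]
      exact Finset.sum_congr rfl fun n _ => by ring
    have e2 : ∀ (γ x : ℕ → ℝ) (N : ℕ), ∑ n ∈ Finset.range N, (γ n / w) ^ 2 * x n =
        (∑ n ∈ Finset.range N, γ n ^ 2 * x n) / w ^ 2 := by
      intro γ x N
      rw [Finset.sum_div]
      exact Finset.sum_congr rfl fun n _ => by rw [div_pow]; ring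
    have e3 : ∀ (γ : ℕ → ℝ) (N : ℕ), ∑ n ∈ Finset.range N, γ n / w * r ^ (n + 1) +
        (1 - a) * (1 + a * r) / (1 - r) *
          ∑ n ∈ Finset.range N, (γ n / w) ^ 2 * r ^ (2 * (n + 1)) =
        (∑ n ∈ Finset.range N, γ n * r ^ (n + 1) + 1 / (1 + a) * ((1 + a * r) / (1 - r)) *
          ∑ n ∈ Finset.range N, γ n ^ 2 * r ^ (2 * (n + 1))) / w := by
      intro γ N
      rw [e1, e2 γ (fun n => r ^ (2 * (n + 1))), ← hΛ]
      field_simp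
    have key := majorant_le (α := fun n => A n / w) (β := fun n => ‖d n‖ / w) (a := a)
      (c := ‖taylorCoeff ω 0‖) (r := r) (fun n => div_nonneg (hA0 n) hw.le) (by positivity)
      ha0 ha1 (norm_nonneg _) hω1 hr0 hr
      (fun N => by
        rw [e3, div_le_iff₀ hw, mul_comm (r / (1 - r))]
        exact hbohr N)
      (fun N => by
        have e4 : ∀ γ : ℕ → ℝ, ∑ n ∈ Finset.range N, (((n : ℝ) + 1) * (γ n / w)) ^ 2 =
            (∑ n ∈ Finset.range N, (((n : ℝ) + 1) * γ n) ^ 2) / w ^ 2 := by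
          intro γ
          rw [Finset.sum_div]
          exact Finset.sum_congr rfl fun n _ => by rw [← mul_div_assoc, div_pow]
        rw [e4, e4]
        exact div_le_div_of_nonneg_right (hL N) (by positivity))
      (fun ρ h0 h1 N => by
        rw [e2 A (fun n => ρ ^ (n + 1)), ← mul_div_assoc, div_le_iff₀ (by positivity), mul_comm ρ]
        exact hrho ρ h0 h1 N)
      (fun n => by
        have e5 : ∑ j ∈ Finset.range n, ((j : ℝ) + 1) * (A j / w) =
            (∑ j ∈ Finset.range n, ((j : ℝ) + 1) * A j) / w := by
          rw [Finset.sum_div]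
          exact Finset.sum_congr rfl fun n _ => by ring
        rw [e5, ← mul_div_assoc, ← mul_div_assoc, ← mul_div_assoc, ← mul_div_assoc, ← add_div]
        exact div_le_div_of_nonneg_right (hB n) hw.le) N
    rw [e3, div_le_iff₀ hw, mul_comm (r / (1 - r))] at key
    exact key
  · have hAz : ∀ n, A n = 0 := by
      intro n
      have h := hF.norm_taylorCoeff_succ_le n
      rw [← ha, ha1] at h
      exact le_antisymm (by linarith) (hA0 n)
    have hdz : ∀ n, ‖d n‖ = 0 := by
      intro n
      have h := hL (n + 1)
      simp only [hAz, mul_zero, ne_eq, OfNat.ofNat_ne_zero, not_false_eq_true, zero_pow,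
        Finset.sum_const_zero] at h
      have h2 := (Finset.sum_eq_zero_iff_of_nonneg fun i _ => sq_nonneg _).1
        (le_antisymm h (Finset.sum_nonneg fun i _ => sq_nonneg _)) n (by simp)
      have : (n : ℝ) + 1 ≠ 0 := by positivity
      simpa [this] using h2
    simp [hdz, ha1]

/-! ### The bound for harmonic mappings -/

theorem taylorCoeff_h₀_succ (f : HarmonicMapping) (n : ℕ) :
    taylorCoeff f.h₀ (n + 1) = taylorCoeff f.h (n + 1) := by
  have h := taylorPS_sub (f.analytic_h 0 zero_mem_unitBall)
    (analyticAt_const (𝕜 := ℂ) (v := f.h 0) (x := (0 : ℂ)))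
  rw [taylorPS_const] at h
  have h2 := congrArg (coeff (n + 1)) h
  simp only [coeff_taylorPS, map_sub, PowerSeries.coeff_C, Nat.succ_ne_zero, if_false,
    sub_zero] at h2
  exact h2

theorem cConst_mul_sq (k : ℝ) : cConst k * k ^ 2 = k := by
  unfold cConst
  split_ifs with h
  · simp [h]
  · field_simp

/-- The h-part contributes the factor 1 and the g-part the factor k. Dividing g' by kh' and then
keeping only ωh' covers k = 0 as well. -/
theorem harmonicClass_E_le {k r : ℝ} (hk : 0 ≤ k) {f : HarmonicMapping} (hf : f ∈ harmonicClass k)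
    (hr0 : 0 ≤ r) (hr : r ≤ 1 / 2) :
    f.E k r ≤ (1 + k) * (1 - ‖f.h 0‖ ^ 2) * (r / (1 - r)) := by
  have hr1 : r < 1 := by linarith
  have hF : IsSchur f.h := ⟨f.analytic_h, hf.1⟩
  have hkan : AnalyticOnNhd ℂ ((fun _ => (k : ℂ)) * deriv f.h) (ball 0 1) := fun z hz =>
    analyticAt_const.mul (f.analytic_h z hz).deriv
  obtain ⟨ω, hω, hωe⟩ := exists_schur_mul_eq hkan f.analytic_g.deriv (fun z hz => by
    simpa [abs_of_nonneg hk] using hf.2 z hz)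
  rw [taylorPS_mul analyticAt_const (f.analytic_h 0 zero_mem_unitBall).deriv, taylorPS_const,
    mul_left_comm] at hωe
  set d : ℕ → ℂ := fun n => coeff n (taylorPS ω * taylorPS (deriv f.h)) / (n + 1) with hd
  have hd1 : ∀ n : ℕ, ((n : ℂ) + 1) * d n = coeff n (taylorPS ω * taylorPS (deriv f.h)) := by
    intro n
    have : (n : ℂ) + 1 ≠ 0 := Nat.cast_add_one_ne_zero n
    rw [hd]; field_simp
  have hb : ∀ n, ‖taylorCoeff f.g (n + 1)‖ = k * ‖d n‖ := by
    intro n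
    have h1 := congrArg (coeff n) hωe
    rw [coeff_taylorPS, taylorCoeff_deriv, PowerSeries.coeff_C_mul, ← hd1, mul_left_comm] at h1
    rw [mul_left_cancel₀ (Nat.cast_add_one_ne_zero n) h1, norm_mul, Complex.norm_real,
      Real.norm_of_nonneg hk]
  have s1 := summable_majorantSum f.analytic_h hr0 hr1
  have s2 := summable_majorantSum f.analytic_g hr0 hr1
  have s3 := summable_radialNormSq f.analytic_h hr0 hr1
  have s4 := summable_radialNormSq f.analytic_g hr0 hr1
  have t1 := s1.hasSum.tendsto_sum_nat
  have t2 := s2.hasSum.tendsto_sum_nat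
  have t3 := s3.hasSum.tendsto_sum_nat
  have t4 := s4.hasSum.tendsto_sum_nat
  have t := (t1.add t2).add ((t3.add (t4.const_mul (cConst k))).const_mul
    (1 / (1 + ‖f.a 0‖) * ((1 + ‖f.a 0‖ * r) / (1 - r))))
  unfold HarmonicMapping.E radialNormSq majorantSum
  simp only [taylorCoeff_h₀_succ]
  refine le_of_tendsto' t fun N => ?_
  have k1 := hF.refined_bohr hr0 hr1 N
  have k2 := mul_le_mul_of_nonneg_left (hF.refined_bohr_of_deriv hω hd1 hr0 hr N) hk
  have e1 : ∑ n ∈ Finset.range N, ‖taylorCoeff f.g (n + 1)‖ * r ^ (n + 1) =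
      k * ∑ n ∈ Finset.range N, ‖d n‖ * r ^ (n + 1) := by
    rw [Finset.mul_sum]
    exact Finset.sum_congr rfl fun n _ => by rw [hb, mul_assoc]
  have e2 : cConst k * ∑ n ∈ Finset.range N, ‖taylorCoeff f.g (n + 1)‖ ^ 2 * r ^ (2 * (n + 1)) =
      k * ∑ n ∈ Finset.range N, ‖d n‖ ^ 2 * r ^ (2 * (n + 1)) := by
    nth_rewrite 2 [← cConst_mul_sq k]
    rw [mul_assoc, Finset.mul_sum _ _ (k ^ 2)]
    congr 1
    exact Finset.sum_congr rfl fun n _ => by rw [hb]; ring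
  rw [e1, e2, HarmonicMapping.a, ← taylorCoeff_zero f.h]
  linarith

theorem rpow_add_E_le_one {k p r : ℝ} (hk : 0 ≤ k) (hp0 : 0 < p) (hp2 : p ≤ 2)
    {f : HarmonicMapping} (hf : f ∈ harmonicClass k) (hr0 : 0 ≤ r)
    (hr : r ≤ p / (2 * (1 + k) + p)) : ‖f.h 0‖ ^ p + f.E k r ≤ 1 := by
  have hden : 0 < 2 * (1 + k) + p := by positivity
  rw [le_div_iff₀ hden] at hr
  have hr2 : r ≤ 1 / 2 := by nlinarith
  have hE := harmonicClass_E_le hk hf hr0 hr2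
  have h1r : 0 < 1 - r := by linarith
  have hx1 : ‖f.h 0‖ ≤ 1 := hf.1 0 zero_mem_unitBall
  have hx0 := norm_nonneg (f.h 0)
  set x := ‖f.h 0‖
  have hw : 0 ≤ 1 - x ^ 2 := by nlinarith
  have h1 : (1 + k) * (r / (1 - r)) ≤ p / 2 := by
    rw [← mul_div_assoc, div_le_iff₀ h1r]
    linarith
  have h2 : x ^ p ≤ 1 + p / 2 * (x ^ 2 - 1) := by
    -- Bernoulli's inequality for (x²)^(p/2); its exponent is at most 1 because p ≤ 2.
    have h3 := rpow_one_add_le_one_add_mul_self (s := x ^ 2 - 1) (p := p / 2)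
      (by nlinarith) (by linarith) (by linarith)
    rwa [add_sub_cancel, ← Real.rpow_natCast, ← Real.rpow_mul hx0, Nat.cast_ofNat,
      mul_div_cancel₀ p two_ne_zero, Real.rpow_ofNat] at h3
  have h4 := mul_le_mul_of_nonneg_right h1 hw
  linarith

/-! ### Sharpness: Möbius examples -/

theorem one_sub_mul_ne_zero {a : ℝ} (ha0 : 0 ≤ a) (ha1 : a < 1) {z : ℂ} (hz : z ∈ ball (0 : ℂ) 1) :
    1 - (a : ℂ) * z ≠ 0 := by
  intro h0
  have h1 : ‖(a : ℂ) * z‖ = 1 := by rw [← sub_eq_zero.1 h0]; simp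
  rw [norm_mul, Complex.norm_real, Real.norm_of_nonneg ha0] at h1
  rw [mem_ball_zero_iff] at hz
  nlinarith [norm_nonneg z]

theorem analyticOnNhd_moebius {a : ℝ} (ha0 : 0 ≤ a) (ha1 : a < 1) :
    AnalyticOnNhd ℂ (fun z : ℂ => (a - z) / (1 - a * z)) (ball 0 1) := fun _ hz =>
  (analyticAt_const.sub analyticAt_id).div
    (analyticAt_const.sub (analyticAt_const.mul analyticAt_id)) (one_sub_mul_ne_zero ha0 ha1 hz)

/-- The harmonic mapping with `h z = (a - z) / (1 - a z)` and `g = k (h - h 0)`. -/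
noncomputable def moebiusHarmonic (k a : ℝ) (ha0 : 0 ≤ a) (ha1 : a < 1) : HarmonicMapping where
  h := fun z => (a - z) / (1 - a * z)
  g := fun z => k * ((a - z) / (1 - a * z) - a)
  analytic_h := analyticOnNhd_moebius ha0 ha1
  analytic_g := fun _ hz => analyticAt_const.mul
    ((analyticOnNhd_moebius ha0 ha1 _ hz).sub analyticAt_const)
  g_zero := by simp

theorem taylorCoeff_moebius {a : ℝ} (ha0 : 0 ≤ a) (ha1 : a < 1) (n : ℕ) :
    taylorCoeff (fun z : ℂ => (a - z) / (1 - a * z)) (n + 1) = -(1 - a ^ 2) * a ^ n := by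
  set H : ℂ → ℂ := fun z => (a - z) / (1 - a * z) with hH
  have hH0 := analyticOnNhd_moebius ha0 ha1 0 zero_mem_unitBall
  rw [← hH] at hH0
  have hid : AnalyticAt ℂ (fun z : ℂ => z) 0 := analyticAt_id
  have e1 : ((fun _ => 1) - (fun _ => (a : ℂ)) * (fun z => z)) * H =ᶠ[𝓝 0]
      (fun _ => (a : ℂ)) - (fun z => z) := by
    filter_upwards [ball_mem_nhds (0 : ℂ) one_pos] with z hz
    simp only [Pi.sub_apply, Pi.mul_apply, hH]
    exact mul_div_cancel₀ _ (one_sub_mul_ne_zero ha0 ha1 hz)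
  have e2 := taylorPS_congr e1
  rw [taylorPS_mul (analyticAt_const.sub (analyticAt_const.mul hid)) hH0,
    taylorPS_sub analyticAt_const (analyticAt_const.mul hid), taylorPS_mul analyticAt_const hid,
    taylorPS_sub analyticAt_const hid, taylorPS_const, taylorPS_const, taylorPS_id, map_one,
    sub_mul, one_mul, mul_assoc] at e2
  have e3 : ∀ m, taylorCoeff H (m + 1) - a * taylorCoeff H m = -(if m = 0 then 1 else 0) := by
    intro m
    have := congrArg (coeff (m + 1)) e2
    simpa [PowerSeries.coeff_C, PowerSeries.coeff_X, PowerSeries.coeff_succ_X_mul] using this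
  induction n with
  | zero =>
    have h := e3 0
    rw [taylorCoeff_zero, if_pos rfl] at h
    have h2 : H 0 = a := by simp [hH]
    rw [h2] at h
    linear_combination h
  | succ n ih =>
    have h := e3 (n + 1)
    rw [if_neg n.succ_ne_zero, ih] at h
    linear_combination h

theorem moebiusHarmonic_mem {k a : ℝ} (hk : 0 ≤ k) (ha0 : 0 ≤ a) (ha1 : a < 1) :
    moebiusHarmonic k a ha0 ha1 ∈ harmonicClass k := by
  refine ⟨fun z hz => ?_, fun z hz => ?_⟩
  · change ‖((a : ℂ) - z) / (1 - a * z)‖ ≤ 1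
    rw [norm_div]
    refine div_le_one_of_le₀ (le_of_sq_le_sq ?_ (norm_nonneg _)) (norm_nonneg _)
    have h := normSq_one_sub_conj_mul_sub (a : ℂ) z
    rw [Complex.conj_ofReal, Complex.norm_real, Real.norm_of_nonneg ha0] at h
    rw [mem_ball_zero_iff] at hz
    have h4 : 0 ≤ (1 - a ^ 2) * (1 - ‖z‖ ^ 2) := by
      apply mul_nonneg <;> nlinarith [norm_nonneg z]
    linarith
  · have hd := (analyticOnNhd_moebius ha0 ha1 z hz).differentiableAt
    have h : deriv (moebiusHarmonic k a ha0 ha1).g z =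
        k * deriv (moebiusHarmonic k a ha0 ha1).h z := by
      simp only [moebiusHarmonic]
      rw [deriv_const_mul _ (hd.sub_const _), deriv_sub_const]
    rw [h, norm_mul, Complex.norm_real, Real.norm_of_nonneg hk]

theorem E_moebiusHarmonic {k a r : ℝ} (hk : 0 ≤ k) (ha0 : 0 ≤ a) (ha1 : a < 1) (hr0 : 0 ≤ r)
    (hr1 : r < 1) :
    (moebiusHarmonic k a ha0 ha1).E k r = (1 + k) * (1 - a ^ 2) * (r / (1 - r)) := by
  set f := moebiusHarmonic k a ha0 ha1 with hf
  have hw : 0 ≤ 1 - a ^ 2 := by nlinarith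
  have hA : ∀ n, ‖taylorCoeff f.h (n + 1)‖ = (1 - a ^ 2) * a ^ n := by
    intro n
    have h : taylorCoeff f.h (n + 1) = ((-(1 - a ^ 2) * a ^ n : ℝ) : ℂ) := by
      push_cast; exact taylorCoeff_moebius ha0 ha1 n
    rw [h, Complex.norm_real, neg_mul, norm_neg, Real.norm_of_nonneg (by positivity)]
  have hB : ∀ n, ‖taylorCoeff f.g (n + 1)‖ = k * ((1 - a ^ 2) * a ^ n) := by
    intro n
    have hh := f.analytic_h 0 zero_mem_unitBall
    have e : f.g = (fun _ => (k : ℂ)) * (f.h - fun _ => (a : ℂ)) := rfl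
    have h2 := taylorPS_mul (analyticAt_const (𝕜 := ℂ) (v := (k : ℂ)) (x := (0 : ℂ)))
      (hh.sub (analyticAt_const (v := (a : ℂ))))
    rw [← e, taylorPS_const, taylorPS_sub hh analyticAt_const, taylorPS_const] at h2
    have h3 := congrArg (coeff (n + 1)) h2
    simp only [coeff_taylorPS, PowerSeries.coeff_C_mul, map_sub, PowerSeries.coeff_C,
      Nat.succ_ne_zero, if_false, sub_zero] at h3
    rw [h3, norm_mul, Complex.norm_real, Real.norm_of_nonneg hk, hA]
  have h0 : ‖f.a 0‖ = a := by
    rw [HarmonicMapping.a, taylorCoeff_zero, hf]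
    simp [moebiusHarmonic, abs_of_nonneg ha0]
  have har0 : 0 ≤ a * r := mul_nonneg ha0 hr0
  have har : a * r < 1 := by nlinarith
  have hs1 : HasSum (fun n : ℕ => (1 - a ^ 2) * a ^ n * r ^ (n + 1))
      ((1 - a ^ 2) * r * (1 - a * r)⁻¹) := by
    refine ((hasSum_geometric_of_lt_one har0 har).mul_left ((1 - a ^ 2) * r)).congr_fun ?_
    intro n; rw [mul_pow]; ring
  have hs2 : HasSum (fun n : ℕ => ((1 - a ^ 2) * a ^ n) ^ 2 * r ^ (2 * (n + 1)))
      (((1 - a ^ 2) * r) ^ 2 * (1 - (a * r) ^ 2)⁻¹) := by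
    refine ((hasSum_geometric_of_lt_one (sq_nonneg (a * r)) (by nlinarith)).mul_left
      (((1 - a ^ 2) * r) ^ 2)).congr_fun ?_
    intro n; ring
  have m1 : majorantSum f.h r = (1 - a ^ 2) * r * (1 - a * r)⁻¹ := by
    simp only [majorantSum, hA]; exact hs1.tsum_eq
  have m2 : majorantSum f.g r = k * ((1 - a ^ 2) * r * (1 - a * r)⁻¹) := by
    simp only [majorantSum, hB]
    rw [← hs1.tsum_eq, ← tsum_mul_left]
    exact tsum_congr fun n => by ring
  have m3 : radialNormSq f.h₀ r = ((1 - a ^ 2) * r) ^ 2 * (1 - (a * r) ^ 2)⁻¹ := by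
    simp only [radialNormSq, taylorCoeff_h₀_succ, hA]; exact hs2.tsum_eq
  have m4 : radialNormSq f.g r = k ^ 2 * (((1 - a ^ 2) * r) ^ 2 * (1 - (a * r) ^ 2)⁻¹) := by
    simp only [radialNormSq, hB]
    rw [← hs2.tsum_eq, ← tsum_mul_left]
    exact tsum_congr fun n => by ring
  rw [HarmonicMapping.E, m1, m2, m3, m4, h0, ← mul_assoc (cConst k), cConst_mul_sq]
  have d1 : 1 - a * r ≠ 0 := by linarith
  have d2 : 1 + a * r ≠ 0 := by positivity
  have d3 : 1 - r ≠ 0 := by linarith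
  have d4 : 1 + a ≠ 0 := by positivity
  have e5 : 1 - (a * r) ^ 2 = (1 - a * r) * (1 + a * r) := by ring
  rw [e5]
  field_simp
  ring

/-- The function t^p + C(1-t²) equals 1 at t = 1 and has derivative p - 2C < 0 there, so it exceeds
1 just to the left. -/
theorem exists_one_lt_rpow_add {p C : ℝ} (hC : p < 2 * C) :
    ∃ a : ℝ, 0 ≤ a ∧ a < 1 ∧ 1 < a ^ p + C * (1 - a ^ 2) := by
  have hd : HasDerivAt (fun t : ℝ => t ^ p + C * (1 - t ^ 2)) (p - 2 * C) 1 := by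
    have h1 := Real.hasDerivAt_rpow_const (x := 1) (p := p) (Or.inl one_ne_zero)
    have h2 := (((hasDerivAt_pow 2 (1 : ℝ)).const_sub 1).const_mul C)
    refine (h1.add h2).congr_deriv ?_
    norm_num
    ring
  have hs := (hasDerivAt_iff_tendsto_slope.1 hd).eventually_lt_const (by linarith : p - 2 * C < 0)
  have hs' := hs.filter_mono (nhdsWithin_mono (1 : ℝ)
    (fun x (hx : x ∈ Iio (1 : ℝ)) => ne_of_lt hx))
  have h0 : ∀ᶠ t : ℝ in 𝓝[<] 1, 0 < t := nhdsWithin_le_nhds (eventually_gt_nhds one_pos)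
  obtain ⟨t, ⟨h1, h2⟩, h3⟩ := ((hs'.and h0).and self_mem_nhdsWithin).exists
  have h3 : t < 1 := h3
  refine ⟨t, h2.le, h3, ?_⟩
  rw [slope_def_field, div_neg_iff] at h1
  rcases h1 with h1 | h1
  · simp at h1
    linarith [h1.1]
  · linarith [h1.2]

theorem corollary6 (k p : ℝ) (hk0 : 0 ≤ k) (hk1 : k ≤ 1) (hp0 : 0 < p) (hp2 : p ≤ 2) :
    (∀ f ∈ harmonicClass k, ∀ q : ℕ, analyticOrderAt f.h₀ 0 = (q : ℕ∞) →
      (k ≠ 0 → ‖f.b q‖ ≤ 1 / (2 * k * ‖f.a q‖)) →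
      ∀ r : ℝ, 0 ≤ r → r ≤ p / (2 * (1 + k) + p) →
        ‖f.h 0‖ ^ p + f.E k r ≤ 1) ∧
    ((k = 0 ∨ k = 1 ∨ p ≤ 1 ∨ (0 < k ∧ k < 1 ∧ 1 < p ∧ p < 2 ∧ p - 1 ≤ k)) →
      (∀ f ∈ harmonicClass k, ∀ r : ℝ, 0 ≤ r → r ≤ p / (2 * (1 + k) + p) →
        ‖f.h 0‖ ^ p + f.E k r ≤ 1) ∧
      (∀ r : ℝ, p / (2 * (1 + k) + p) < r → r < 1 →
        ∃ f ∈ harmonicClass k, 1 < ‖f.h 0‖ ^ p + f.E k r)) := by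
  refine ⟨fun f hf q _ _ r hr0 hr => rpow_add_E_le_one hk0 hp0 hp2 hf hr0 hr, fun _ =>
    ⟨fun f hf r hr0 hr => rpow_add_E_le_one hk0 hp0 hp2 hf hr0 hr, fun r hr hr1 => ?_⟩⟩
  have hden : 0 < 2 * (1 + k) + p := by positivity
  have hr0 : 0 < r := lt_trans (by positivity) hr
  have h1r : 0 < 1 - r := by linarith
  rw [div_lt_iff₀ hden] at hr
  have hC : p < 2 * ((1 + k) * (r / (1 - r))) := by
    rw [← mul_div_assoc, ← mul_div_assoc, lt_div_iff₀ h1r]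
    linarith
  obtain ⟨a, ha0, ha1, ha⟩ := exists_one_lt_rpow_add hC
  refine ⟨moebiusHarmonic k a ha0 ha1, moebiusHarmonic_mem hk0 ha0 ha1, ?_⟩
  have h0 : ‖(moebiusHarmonic k a ha0 ha1).h 0‖ = a := by
    simp [moebiusHarmonic, abs_of_nonneg ha0]
  rw [E_moebiusHarmonic hk0 ha0 ha1 hr0.le hr1, h0]
  linarith
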